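/- **Conventions.** Fields are smooth complex-valued functions of $x\in\mathbb R$; $'$ and subscripts denote derivatives, $S(\eta)=\frac{\eta'''}{\eta'}-\frac32\left(\frac{\eta''}{\eta'}\right)^2$ is the Schwarzian derivative, and $\operatorname{sign}(0)=0$. Consider five spaces of fields, with the following Poisson brackets of evaluation functionals (understood as distributions in $(x,y)$): - $\eta$ with $\eta'$ nowhere zero: $\{\eta(x),\eta(y)\}=\tfrac12\bigl[\eta(x)^2-\eta(y)^2-\operatorname{sign}(x-y)(\eta(x)-\eta(y))^2\bigr]$; - $\rho$ nowhere zero: $\{\rho(x),\rho(y)\}=\rho(x)\rho(y)\bigl[\sinh\int_x^y\rho\,ds+\operatorname{sign}(x-y)\cosh\int_x^y\rho\,ds\bigr]$; - $\theta$ nowhere zero: $\{\theta(x),\theta(y)\}=\operatorname{sign}(x-y)\theta(x)\theta(y)$; - $v$: $\{v(x),v(y)\}=-\tfrac12\delta'(x-y)$; - $u$: $\{u(x),u(y)\}=\tfrac12\delta'''(x-y)+\delta'(x-y)[u(x)+u(y)]$. If functionals $F,G$ have compactly supported smooth variational derivatives at $q$, then $\{F,G\}(q)=\iint\frac{\delta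 F}{\delta q}(x)\{q(x),q(y)\}\frac{\delta G}{\delta q}(y)\,dx\,dy$. A map $\Phi$ is Poisson if $\{F\circ\Phi,G\circ\Phi\}=\{F,G\}\circ\Phi$ for such functionals. **Proposition.** 1. The following maps are Poisson: $\eta\mapsto\rho=\eta'/\eta$ (on the curves $\eta$ without zeros), $\eta\mapsto\theta=\eta'$, $\eta\mapsto v=\tfrac12\eta''/\eta'$, $\eta\mapsto u=\tfrac12S(\eta)$, $\rho\mapsto v=\tfrac12(\rho+\rho'/\rho)$, $\theta\mapsto v=\tfrac12\theta'/\theta$, $v\mapsto u=v'-v^2$. 2. The diagram formed by these maps commutes: the two composites $\eta\mapsto\rho\mapsto v$ and $\eta\mapsto\theta\mapsto v$ equal $\eta\mapsto v$ (the first one where $\eta\neq0$), and $\eta\mapsto v\mapsto u$ equals $\eta\mapsto u$. 3. Let $a<b$ (for the circle $\mathbb R/2\pi\mathbb Z$, take $b=a+2\pi$), and let $H=\int_a^b u^2\,dx$, expressed on each level through the maps above. Then on $(a,b)$ the Hamiltonian equation $q_t=\{q,H\}$ is, for $q=\eta,\rho,\theta,v,u$ respectively, $$\eta_t=S(\eta)\eta_x,\qquad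 \rho_t=\rho_{xxx}-\tfrac32(\rho_x^2/\rho)_x-\tfrac12(\rho^3)_x,\qquad \theta_t=\theta_{xxx}-\tfrac32(\theta_x^2/\theta)_x,$$ $$v_t=v_{xxx}-6v^2v_x,\qquad u_t=u_{xxx}+6uu_x.$$ That is, for every smooth $f$ with compact support in $(a,b)$, $\{\int f q\,dx,\,H\}$, defined as minus the derivative of $H$ along the Hamiltonian vector field $x\mapsto\int\{q(x),q(y)\}f(y)\,dy$ of $\int fq\,dx$, equals $\int f\,V(q)\,dx$, where $V(q)$ is the right-hand side of the equation. 4. If $\eta$ is quasi-periodic, $\eta(x+2\pi)=\frac{\alpha\eta(x)+\gamma}{\beta\eta(x)+\delta}$ with a constant matrix $\begin{pmatrix}\alpha&\beta\\\gamma&\delta\end{pmatrix}\in SL(2,\mathbb C)$, then $u=\tfrac12S(\eta)$ is $2\pi$-periodic, and $\int_a^{a+2\pi}u^2dx=\int_0^{2\pi}u^2dx$ for every real $a$. 5. Each of the maps in 1 sends smooth solutions, on any open set of points $(t,x)\in\mathbb R^2$, of the equation of its source (with $\eta_x\ne0$, resp. $\rho\neq0$, $\theta\ne0$ on that set, and also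 $\eta\neq0$ for $\eta\mapsto\rho$) to solutions of the equation of its target. -/

import Mathlib

open scoped ContDiff

noncomputable section

namespace KdVTower

/-! ### Spaces of fields, functionals, and Poisson maps -/

/-- A space of (smooth, complex valued) functions `q` of one real variable, with a Poisson bracket of
the evaluation functionals `q(x)`, recorded as the operator
`(poisson q f)(x) = ∫ {q(x), q(y)} f(y) dy` on test functions `f`. -/
structure FieldSpace where
  carrier : Set (ℝ → ℂ)
  poisson : (ℝ → ℂ) → (ℝ → ℂ) → ℝ → ℂ

/-- Smooth compactly supported functions. -/
def IsTest (f : ℝ → ℂ) : Prop := ContDiff ℝ ∞ f ∧ HasCompactSupport f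

/-- `Q` is a smooth one-parameter family in `S` passing through `q` at `s = 0` with velocity `h`. -/
def IsVariation (S : Set (ℝ → ℂ)) (q h : ℝ → ℂ) (Q : ℝ → ℝ → ℂ) : Prop :=
  ContDiff ℝ ∞ (fun p : ℝ × ℝ => Q p.1 p.2) ∧ (∀ s, Q s ∈ S) ∧ Q 0 = q ∧
    ∀ x, HasDerivAt (fun s => Q s x) (h x) 0

/-- The functional `F` on `X` has at `q` the variational derivative `δF/δq = f`, a test function:
`dF(h) = ∫ f h dx`. -/
def FieldSpace.HasGradient (X : FieldSpace) (F : (ℝ → ℂ) → ℂ) (q f : ℝ → ℂ) : Prop :=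
  IsTest f ∧ ∀ (h : ℝ → ℂ) (Q : ℝ → ℝ → ℂ), IsVariation X.carrier q h Q →
    HasDerivAt (fun s => F (Q s)) (∫ x, f x * h x) 0

/-- `{F, G}(q) = c`, where `{F, G}(q) = ∬ (δF/δq)(x) {q(x), q(y)} (δG/δq)(y) dx dy`. -/
def FieldSpace.HasBracket (X : FieldSpace) (F G : (ℝ → ℂ) → ℂ) (q : ℝ → ℂ) (c : ℂ) : Prop :=
  ∃ f g : ℝ → ℂ, X.HasGradient F q f ∧ X.HasGradient G q g ∧ c = ∫ x, f x * X.poisson q g x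

/-- `Φ` maps `X` to `Y` and `{F ∘ Φ, G ∘ Φ} = {F, G} ∘ Φ`. -/
def IsPoissonMap (X Y : FieldSpace) (Φ : (ℝ → ℂ) → ℝ → ℂ) : Prop :=
  (∀ q ∈ X.carrier, Φ q ∈ Y.carrier) ∧
  ∀ q ∈ X.carrier, ∀ (F G : (ℝ → ℂ) → ℂ) (c : ℂ),
    Y.HasBracket F G (Φ q) c → X.HasBracket (fun p => F (Φ p)) (fun p => G (Φ p)) q c

/-- On the interval `(a, b)` the functional `H` generates the evolution equation `q_t = V(q)`, that is,
`{q(x), H} = V(q)(x)` for `a < x < b` in the sense of distributions. Indeed, the smeared evaluation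
functional `∫ f q` (or any functional with gradient `f`) has Hamiltonian vector field `poisson q f`,
so that `{∫ f q, H} = - {H, ∫ f q} = - dH(poisson q f)`. -/
def FieldSpace.Generates (X : FieldSpace) (a b : ℝ) (H : (ℝ → ℂ) → ℂ)
    (V : (ℝ → ℂ) → ℝ → ℂ) : Prop :=
  ∀ q ∈ X.carrier, ∀ f : ℝ → ℂ, IsTest f → tsupport f ⊆ Set.Ioo a b →
    HasDerivAt (fun s : ℝ => H (fun x => q x + (s : ℂ) * X.poisson q f x))
      (-∫ x, f x * V q x) 0

/-! ### The differential substitutions -/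

/-- The Schwarzian derivative. -/
def schwarzian (η : ℝ → ℂ) (x : ℝ) : ℂ :=
  iteratedDeriv 3 η x / deriv η x - 3 / 2 * (iteratedDeriv 2 η x / deriv η x) ^ 2

def etaToRho (η : ℝ → ℂ) (x : ℝ) : ℂ := deriv η x / η x

def etaToTheta (η : ℝ → ℂ) (x : ℝ) : ℂ := deriv η x

def etaToV (η : ℝ → ℂ) (x : ℝ) : ℂ := 1 / 2 * (iteratedDeriv 2 η x / deriv η x)

def etaToU (η : ℝ → ℂ) (x : ℝ) : ℂ := 1 / 2 * schwarzian η x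

def rhoToV (ρ : ℝ → ℂ) (x : ℝ) : ℂ := 1 / 2 * (ρ x + deriv ρ x / ρ x)

def thetaToV (θ : ℝ → ℂ) (x : ℝ) : ℂ := 1 / 2 * (deriv θ x / θ x)

def vToU (v : ℝ → ℂ) (x : ℝ) : ℂ := deriv v x - v x ^ 2

/-! ### The Poisson brackets -/

/-- `sign (x - y)` as a complex number. -/
def sgn (x y : ℝ) : ℂ := ((Real.sign (x - y) : ℝ) : ℂ)

/-- `{η(x), η(y)} = ½ (η(x)² - η(y)² - sign(x - y) (η(x) - η(y))²)`. -/
def etaPoisson (η f : ℝ → ℂ) (x : ℝ) : ℂ :=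
  ∫ y, 1 / 2 * (η x ^ 2 - η y ^ 2 - sgn x y * (η x - η y) ^ 2) * f y

/-- `{ρ(x), ρ(y)} = ρ(x) ρ(y) (sinh ∫_x^y ρ + sign(x - y) cosh ∫_x^y ρ)`. -/
def rhoPoisson (ρ f : ℝ → ℂ) (x : ℝ) : ℂ :=
  ∫ y, ρ x * ρ y *
    (Complex.sinh (∫ s in x..y, ρ s) + sgn x y * Complex.cosh (∫ s in x..y, ρ s)) * f y

/-- `{θ(x), θ(y)} = sign(x - y) θ(x) θ(y)`. -/
def thetaPoisson (θ f : ℝ → ℂ) (x : ℝ) : ℂ := ∫ y, sgn x y * θ x * θ y * f y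

/-- `{v(x), v(y)} = - ½ δ'(x - y)`. -/
def vPoisson (_v f : ℝ → ℂ) (x : ℝ) : ℂ := -(1 / 2) * deriv f x

/-- `{u(x), u(y)} = ½ δ'''(x - y) + δ'(x - y) (u(x) + u(y))`, the kernel of `½ ∂³ + u ∂ + ∂ u`. -/
def uPoisson (u f : ℝ → ℂ) (x : ℝ) : ℂ :=
  1 / 2 * iteratedDeriv 3 f x + u x * deriv f x + deriv (fun y => u y * f y) x

/-- Curves `η` with nowhere vanishing derivative. -/
def etaSpace : FieldSpace where
  carrier := {η | ContDiff ℝ ∞ η ∧ ∀ x, deriv η x ≠ 0}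
  poisson := etaPoisson

/-- The open subset of `etaSpace` where `η` has no zeros, the domain of `ρ = η'/η`. -/
def etaSpaceStar : FieldSpace where
  carrier := {η | ContDiff ℝ ∞ η ∧ (∀ x, deriv η x ≠ 0) ∧ ∀ x, η x ≠ 0}
  poisson := etaPoisson

def rhoSpace : FieldSpace where
  carrier := {ρ | ContDiff ℝ ∞ ρ ∧ ∀ x, ρ x ≠ 0}
  poisson := rhoPoisson

def thetaSpace : FieldSpace where
  carrier := {θ | ContDiff ℝ ∞ θ ∧ ∀ x, θ x ≠ 0}
  poisson := thetaPoisson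

def vSpace : FieldSpace where
  carrier := {v | ContDiff ℝ ∞ v}
  poisson := vPoisson

def uSpace : FieldSpace where
  carrier := {u | ContDiff ℝ ∞ u}
  poisson := uPoisson

/-! ### The Hamiltonian and the evolution equations -/

/-- `∫ u² dx` over the interval `[a, b]`. -/
def energy (a b : ℝ) (u : ℝ → ℂ) : ℂ := ∫ x in a..b, u x ^ 2

/-- `η_t = S(η) η_x`. -/
def etaFlow (η : ℝ → ℂ) (x : ℝ) : ℂ := schwarzian η x * deriv η x

/-- `ρ_t = ρ_xxx - (3/2) (ρ_x²/ρ)_x - (1/2) (ρ³)_x`. -/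
def rhoFlow (ρ : ℝ → ℂ) (x : ℝ) : ℂ :=
  iteratedDeriv 3 ρ x - 3 / 2 * deriv (fun y => deriv ρ y ^ 2 / ρ y) x
    - 1 / 2 * deriv (fun y => ρ y ^ 3) x

/-- `θ_t = θ_xxx - (3/2) (θ_x²/θ)_x`. -/
def thetaFlow (θ : ℝ → ℂ) (x : ℝ) : ℂ :=
  iteratedDeriv 3 θ x - 3 / 2 * deriv (fun y => deriv θ y ^ 2 / θ y) x

/-- `v_t = v_xxx - 6 v² v_x`. -/
def vFlow (v : ℝ → ℂ) (x : ℝ) : ℂ := iteratedDeriv 3 v x - 6 * v x ^ 2 * deriv v x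

/-- `u_t = u_xxx + 6 u u_x`. -/
def uFlow (u : ℝ → ℂ) (x : ℝ) : ℂ := iteratedDeriv 3 u x + 6 * u x * deriv u x

/-- `q(t, x)` is a smooth solution of `q_t = V(q)` on the set `Ω` of points `(t, x)`. -/
def IsSolutionOn (Ω : Set (ℝ × ℝ)) (V : (ℝ → ℂ) → ℝ → ℂ) (q : ℝ → ℝ → ℂ) : Prop :=
  ContDiffOn ℝ ∞ (fun p : ℝ × ℝ => q p.1 p.2) Ω ∧
    ∀ p ∈ Ω, HasDerivAt (fun t => q t p.2) (V (q p.1) p.2) p.1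

/-- `η(x + 2π) = (α η(x) + γ) / (β η(x) + δ)` for a matrix `M = (α β; γ δ)` in `SL(2, ℂ)`. (The
denominator cannot vanish, because `M` is invertible.) -/
def QuasiPeriodic (η : ℝ → ℂ) : Prop :=
  ∃ M : Matrix.SpecialLinearGroup (Fin 2) ℂ, ∀ x : ℝ,
    η (x + 2 * Real.pi) * (M.1 0 1 * η x + M.1 1 1) = M.1 0 0 * η x + M.1 1 0

end KdVTower

end

open scoped ContDiff

noncomputable section

namespace KdVTower

open Set Filter Topology MeasureTheory

/-! ### Smooth functions on open sets -/

section Local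

variable {O : Set ℝ} {f g : ℝ → ℂ} {x : ℝ}

/-! Every arrow Φ is a differential substitution with a linearization L and a formal adjoint L*. By
the chain rule and integration by parts, F ∘ Φ has gradient L*(δF/δq), so Φ is Poisson as soon as
J_Y = L J_X L*, where J is the operator with kernel the bracket (`isPoissonMap_of_linearization`).
This identity is checked for η → ρ, η → θ, θ → v, ρ → v and v → u; the arrows η → v and η → u follow
by composition, because the diagram commutes.

Three of the J are nonlocal, but tamely so: convolution with the sign is twice an antiderivative, so
its derivative is local (`hasDerivAt_sgnInt`) and it turns an exact derivative into a local term
(`sgnInt_eq_add`). For η the square in the kernel expands into the moments 1, η, η²; for ρ one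
writes ρ = E'/E, and the hyperbolic functions become ratios of values of E. What is left nonlocal
cancels algebraically.

The equations are first rewritten through u: the right-hand sides for η, ρ, θ, v are 2uη', 2(uρ)',
θ(2u' + 4uv) and (u' + 2uv)'. For the Hamiltonian statement, the variation of u along the
Hamiltonian field of ∫fq is local in f, even when the field itself is not: for example it is -η'f on
the η level and ρf' on the ρ level. Then 2u δu + f V(q) is the derivative of an expression that
vanishes with f and its derivatives, hence at both endpoints (`intervalIntegral_eq_neg_integral`).
Solutions are transported because L applied to V at the source is V at the target, a pointwise
differential identity.

For quasi-periodic curves, a Möbius change of η alters v by a logarithmic derivative that drops out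
of v' - v². -/

theorem hasDerivAt_of_smoothOn (hO : IsOpen O) (hf : ContDiffOn ℝ ∞ f O) (hx : x ∈ O) :
    HasDerivAt f (deriv f x) x :=
  ((hf.contDiffAt (hO.mem_nhds hx)).differentiableAt (by simp)).hasDerivAt

theorem smoothOn_deriv (hO : IsOpen O) (hf : ContDiffOn ℝ ∞ f O) : ContDiffOn ℝ ∞ (deriv f) O :=
  hf.deriv_of_isOpen hO (by simp)

theorem eqOn_deriv (hO : IsOpen O) (h : EqOn f g O) : EqOn (deriv f) (deriv g) O := fun _ hy =>
  (h.eventuallyEq_of_mem (hO.mem_nhds hy)).deriv_eq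

theorem eqOn_deriv_of_hasDerivAt {f' : ℝ → ℂ} (hO : IsOpen O) (h : EqOn f g O)
    (hg : ∀ y ∈ O, HasDerivAt g (f' y) y) : EqOn (deriv f) f' O := fun y hy =>
  (eqOn_deriv hO h hy).trans (hg y hy).deriv

theorem iteratedDeriv_two (f : ℝ → ℂ) : iteratedDeriv 2 f = deriv (deriv f) := by
  rw [iteratedDeriv_succ, iteratedDeriv_one]

theorem iteratedDeriv_three (f : ℝ → ℂ) : iteratedDeriv 3 f = deriv (deriv (deriv f)) := by
  rw [iteratedDeriv_succ, iteratedDeriv_two]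

theorem smooth_deriv (hf : ContDiff ℝ ∞ f) : ContDiff ℝ ∞ (deriv f) :=
  (contDiff_infty_iff_deriv.1 hf).2

theorem hasDerivAt_of_smooth (hf : ContDiff ℝ ∞ f) (x : ℝ) : HasDerivAt f (deriv f x) x :=
  (hf.differentiable (by simp) x).hasDerivAt

theorem smooth_div (hf : ContDiff ℝ ∞ f) (hg : ContDiff ℝ ∞ g) (h0 : ∀ x, g x ≠ 0) :
    ContDiff ℝ ∞ (fun x => f x / g x) := by
  simp only [div_eq_mul_inv]
  exact hf.mul (hg.inv h0)

end Local

/-! ### Smooth families of functions -/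

/-- `Q` is a smooth family of functions on the open set `Ω` of points `(t, x)`, with time
derivative `h`. -/
structure IsFlowOn (Ω : Set (ℝ × ℝ)) (Q h : ℝ → ℝ → ℂ) : Prop where
  isOpen : IsOpen Ω
  smooth : ContDiffOn ℝ ∞ (fun p : ℝ × ℝ => Q p.1 p.2) Ω
  hasDerivAt : ∀ p ∈ Ω, HasDerivAt (fun t => Q t p.2) (h p.1 p.2) p.1

theorem isOpen_slice {Ω : Set (ℝ × ℝ)} (hΩ : IsOpen Ω) (t : ℝ) : IsOpen {x | (t, x) ∈ Ω} :=
  hΩ.preimage (by fun_prop : Continuous fun x : ℝ => (t, x))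

theorem smoothOn_slice {Ω : Set (ℝ × ℝ)} {Q : ℝ → ℝ → ℂ}
    (hQ : ContDiffOn ℝ ∞ (fun p : ℝ × ℝ => Q p.1 p.2) Ω) (t : ℝ) :
    ContDiffOn ℝ ∞ (Q t) {x | (t, x) ∈ Ω} :=
  hQ.comp (f := fun x : ℝ => (t, x)) (by fun_prop : ContDiff ℝ ∞ fun x : ℝ => (t, x)).contDiffOn
    fun _ hx => hx

namespace IsFlowOn

variable {Ω : Set (ℝ × ℝ)} {Q h R k : ℝ → ℝ → ℂ}

theorem fderiv_fst (H : IsFlowOn Ω Q h) {p : ℝ × ℝ} (hp : p ∈ Ω) :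
    fderiv ℝ (fun p : ℝ × ℝ => Q p.1 p.2) p (1, 0) = h p.1 p.2 := by
  have hd : HasFDerivAt (fun p : ℝ × ℝ => Q p.1 p.2) _ p :=
    ((H.smooth.contDiffAt (H.isOpen.mem_nhds hp)).differentiableAt (by simp)).hasFDerivAt
  have := hd.comp_hasDerivAt p.1 ((hasDerivAt_id p.1).prodMk (hasDerivAt_const p.1 p.2))
  exact this.unique (H.hasDerivAt p hp)

theorem fderiv_snd (H : IsFlowOn Ω Q h) {p : ℝ × ℝ} (hp : p ∈ Ω) :
    fderiv ℝ (fun p : ℝ × ℝ => Q p.1 p.2) p (0, 1) = deriv (Q p.1) p.2 := by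
  have hd : HasFDerivAt (fun p : ℝ × ℝ => Q p.1 p.2) _ p :=
    ((H.smooth.contDiffAt (H.isOpen.mem_nhds hp)).differentiableAt (by simp)).hasFDerivAt
  have := hd.comp_hasDerivAt p.2 ((hasDerivAt_const p.2 p.1).prodMk (hasDerivAt_id p.2))
  exact this.deriv.symm

theorem smooth_fderiv (H : IsFlowOn Ω Q h) :
    ContDiffOn ℝ ∞ (fderiv ℝ (fun p : ℝ × ℝ => Q p.1 p.2)) Ω :=
  H.smooth.fderiv_of_isOpen H.isOpen (by simp)

theorem smooth_velocity (H : IsFlowOn Ω Q h) :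
    ContDiffOn ℝ ∞ (fun p : ℝ × ℝ => h p.1 p.2) Ω :=
  (H.smooth_fderiv.clm_apply (contDiffOn_const (c := ((1, 0) : ℝ × ℝ)))).congr
    fun _ hp => (H.fderiv_fst hp).symm

/-- Differentiation in `x` commutes with differentiation in `t`. -/
theorem deriv_snd (H : IsFlowOn Ω Q h) :
    IsFlowOn Ω (fun t => deriv (Q t)) (fun t => deriv (h t)) where
  isOpen := H.isOpen
  smooth := (H.smooth_fderiv.clm_apply (contDiffOn_const (c := ((0, 1) : ℝ × ℝ)))).congr
    fun _ hp => (H.fderiv_snd hp).symm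
  hasDerivAt := by
    intro p hp
    set F := fun p : ℝ × ℝ => Q p.1 p.2 with hF
    have hC : ContDiffAt ℝ ∞ F p := H.smooth.contDiffAt (H.isOpen.mem_nhds hp)
    have hd : HasFDerivAt (fderiv ℝ F) (fderiv ℝ (fderiv ℝ F) p) p :=
      ((H.smooth_fderiv.contDiffAt (H.isOpen.mem_nhds hp)).differentiableAt (by simp)).hasFDerivAt
    have h1 : HasDerivAt (fun t => fderiv ℝ F (t, p.2) (0, 1))
        (fderiv ℝ (fderiv ℝ F) p (1, 0) (0, 1)) p.1 :=
      (ContinuousLinearMap.apply ℝ ℂ ((0, 1) : ℝ × ℝ)).hasFDerivAt.comp_hasDerivAt p.1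
        (hd.comp_hasDerivAt p.1 ((hasDerivAt_id p.1).prodMk (hasDerivAt_const p.1 p.2)))
    have h2 : HasDerivAt (fun x => fderiv ℝ F (p.1, x) (1, 0))
        (fderiv ℝ (fderiv ℝ F) p (0, 1) (1, 0)) p.2 :=
      (ContinuousLinearMap.apply ℝ ℂ ((1, 0) : ℝ × ℝ)).hasFDerivAt.comp_hasDerivAt p.2
        (hd.comp_hasDerivAt p.2 ((hasDerivAt_const p.2 p.1).prodMk (hasDerivAt_id p.2)))
    -- Both mixed derivatives are values of the second Fréchet derivative of the joint function at
    -- p, which is symmetric because that function is at least C².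
    have hsymm : IsSymmSndFDerivAt ℝ F p := hC.isSymmSndFDerivAt (by
      simpa using (by exact_mod_cast le_top : ((2 : ℕ∞) : WithTop ℕ∞) ≤ ∞))
    have e1 : (fun t => deriv (Q t) p.2) =ᶠ[𝓝 p.1] fun t => fderiv ℝ F (t, p.2) (0, 1) := by
      have : ∀ᶠ t in 𝓝 p.1, (t, p.2) ∈ Ω :=
        (by fun_prop : Continuous fun t : ℝ => (t, p.2)).continuousAt.eventually
          (H.isOpen.mem_nhds hp)
      filter_upwards [this] with t ht using (H.fderiv_snd ht).symm
    have e2 : h p.1 =ᶠ[𝓝 p.2] fun x => fderiv ℝ F (p.1, x) (1, 0) := by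
      filter_upwards [(isOpen_slice H.isOpen p.1).mem_nhds hp] with x hx
        using (H.fderiv_fst hx).symm
    refine (h1.congr_of_eventuallyEq e1).congr_deriv ?_
    rw [hsymm (1, 0) (0, 1)]
    exact (h2.congr_of_eventuallyEq e2).deriv.symm

theorem add (H : IsFlowOn Ω Q h) (K : IsFlowOn Ω R k) :
    IsFlowOn Ω (fun t x => Q t x + R t x) (fun t x => h t x + k t x) :=
  ⟨H.isOpen, H.smooth.add K.smooth, fun p hp => (H.hasDerivAt p hp).add (K.hasDerivAt p hp)⟩

theorem sub (H : IsFlowOn Ω Q h) (K : IsFlowOn Ω R k) :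
    IsFlowOn Ω (fun t x => Q t x - R t x) (fun t x => h t x - k t x) :=
  ⟨H.isOpen, H.smooth.sub K.smooth, fun p hp => (H.hasDerivAt p hp).sub (K.hasDerivAt p hp)⟩

theorem const_mul (H : IsFlowOn Ω Q h) (c : ℂ) :
    IsFlowOn Ω (fun t x => c * Q t x) (fun t x => c * h t x) :=
  ⟨H.isOpen, contDiffOn_const.mul H.smooth, fun p hp => (H.hasDerivAt p hp).const_mul c⟩

theorem sq (H : IsFlowOn Ω Q h) :
    IsFlowOn Ω (fun t x => Q t x ^ 2) (fun t x => 2 * Q t x * h t x) :=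
  ⟨H.isOpen, H.smooth.pow 2, fun p hp => by
    refine ((H.hasDerivAt p hp).pow 2).congr_deriv ?_
    simp⟩

theorem div (H : IsFlowOn Ω Q h) (K : IsFlowOn Ω R k) (h0 : ∀ p ∈ Ω, R p.1 p.2 ≠ 0) :
    IsFlowOn Ω (fun t x => Q t x / R t x)
      (fun t x => (h t x * R t x - Q t x * k t x) / R t x ^ 2) :=
  ⟨H.isOpen, by
    simp only [div_eq_mul_inv]
    exact H.smooth.mul (K.smooth.inv h0),
    fun p hp => (H.hasDerivAt p hp).div (K.hasDerivAt p hp) (h0 p hp)⟩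

theorem congr (H : IsFlowOn Ω Q h) (e : ∀ p ∈ Ω, R p.1 p.2 = Q p.1 p.2) :
    IsFlowOn Ω R h := by
  refine ⟨H.isOpen, H.smooth.congr e, fun p hp => (H.hasDerivAt p hp).congr_of_eventuallyEq ?_⟩
  have : ∀ᶠ t in 𝓝 p.1, (t, p.2) ∈ Ω :=
    (by fun_prop : Continuous fun t : ℝ => (t, p.2)).continuousAt.eventually
      (H.isOpen.mem_nhds hp)
  filter_upwards [this] with t ht using e _ ht

theorem mono (H : IsFlowOn Ω Q h) {Ω' : Set (ℝ × ℝ)} (hΩ' : IsOpen Ω') (hs : Ω' ⊆ Ω) :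
    IsFlowOn Ω' Q h :=
  ⟨hΩ', H.smooth.mono hs, fun p hp => H.hasDerivAt p (hs hp)⟩

/-- Only {0} × [a, b] has to lie in Ω: by the tube lemma a compact box around it does too, and the
velocity is bounded there, which justifies differentiating under the integral. This matters because
a line of fields may leave the nonvanishing region for large s or far from [a, b]. -/
theorem hasDerivAt_integral (H : IsFlowOn Ω Q h) {a b : ℝ} (hab : a ≤ b)
    (h0 : ∀ x ∈ Icc a b, ((0 : ℝ), x) ∈ Ω) :
    HasDerivAt (fun s => ∫ x in a..b, Q s x) (∫ x in a..b, h 0 x) 0 := by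
  obtain ⟨u, v, hu, hv, h0u, hv', huv⟩ :=
    generalized_tube_lemma (isCompact_singleton (x := (0 : ℝ))) (isCompact_Icc (a := a) (b := b))
      H.isOpen (by
        rintro ⟨s, x⟩ ⟨hs, hx⟩
        obtain rfl : s = 0 := hs
        exact h0 x hx)
  obtain ⟨ε, hε, hεu⟩ := Metric.nhds_basis_closedBall.mem_iff.1
    (hu.mem_nhds (h0u (mem_singleton _)))
  have hsub : Metric.closedBall (0 : ℝ) ε ×ˢ Icc a b ⊆ Ω := (prod_mono hεu hv').trans huv
  obtain ⟨C, hC⟩ := ((isCompact_closedBall (0 : ℝ) ε).prod isCompact_Icc).exists_bound_of_continuousOn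
    (H.smooth_velocity.continuousOn.mono hsub)
  have hI : uIoc a b ⊆ Icc a b := by rw [uIoc_of_le hab]; exact Ioc_subset_Icc_self
  have hcont : ∀ {F : ℝ → ℝ → ℂ}, ContDiffOn ℝ ∞ (fun p : ℝ × ℝ => F p.1 p.2) Ω →
      ∀ s ∈ Metric.closedBall (0 : ℝ) ε, ContinuousOn (F s) (Icc a b) := fun hF s hs =>
    (smoothOn_slice hF s).continuousOn.mono fun x hx => hsub (mk_mem_prod hs hx)
  have h0' : (0 : ℝ) ∈ Metric.closedBall (0 : ℝ) ε := Metric.mem_closedBall_self hε.le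
  refine (intervalIntegral.hasDerivAt_integral_of_dominated_loc_of_deriv_le (μ := volume)
    (F' := h) (bound := fun _ => C)
    (Metric.closedBall_mem_nhds (0 : ℝ) hε) ?_ ?_ ?_ ?_ ?_ ?_).2
  · filter_upwards [Metric.closedBall_mem_nhds (0 : ℝ) hε] with s hs
    exact ((hcont H.smooth s hs).mono hI).aestronglyMeasurable measurableSet_uIoc
  · exact ContinuousOn.intervalIntegrable_of_Icc hab (hcont H.smooth 0 h0')
  · exact ((hcont H.smooth_velocity 0 h0').mono hI).aestronglyMeasurable measurableSet_uIoc
  · exact Eventually.of_forall fun x hx s hs => hC (s, x) (mk_mem_prod hs (hI hx))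
  · exact intervalIntegrable_const
  · exact Eventually.of_forall fun x hx s hs => H.hasDerivAt (s, x) (hsub (mk_mem_prod hs (hI hx)))

end IsFlowOn

theorem IsSolutionOn.isFlowOn {Ω : Set (ℝ × ℝ)} {V : (ℝ → ℂ) → ℝ → ℂ} {q : ℝ → ℝ → ℂ}
    (hΩ : IsOpen Ω) (H : IsSolutionOn Ω V q) : IsFlowOn Ω q (fun t => V (q t)) :=
  ⟨hΩ, H.1, H.2⟩

theorem IsFlowOn.isSolutionOn {Ω : Set (ℝ × ℝ)} {V : (ℝ → ℂ) → ℝ → ℂ} {q h : ℝ → ℝ → ℂ}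
    (H : IsFlowOn Ω q h) (e : ∀ p ∈ Ω, V (q p.1) p.2 = h p.1 p.2) : IsSolutionOn Ω V q :=
  ⟨H.smooth, fun p hp => (e p hp) ▸ H.hasDerivAt p hp⟩

/-! ### Linearizations of the substitutions along families -/

section Substitutions

variable {Ω : Set (ℝ × ℝ)} {Q h : ℝ → ℝ → ℂ}

theorem IsFlowOn.comp_etaToRho (H : IsFlowOn Ω Q h) (h0 : ∀ p ∈ Ω, Q p.1 p.2 ≠ 0) :
    IsFlowOn Ω (fun t => etaToRho (Q t))
      (fun t x => (deriv (h t) x * Q t x - deriv (Q t) x * h t x) / Q t x ^ 2) :=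
  H.deriv_snd.div H h0

theorem IsFlowOn.comp_thetaToV (H : IsFlowOn Ω Q h) (h0 : ∀ p ∈ Ω, Q p.1 p.2 ≠ 0) :
    IsFlowOn Ω (fun t => thetaToV (Q t))
      (fun t x => 1 / 2 * ((deriv (h t) x * Q t x - deriv (Q t) x * h t x) / Q t x ^ 2)) :=
  (H.deriv_snd.div H h0).const_mul (1 / 2)

theorem IsFlowOn.comp_rhoToV (H : IsFlowOn Ω Q h) (h0 : ∀ p ∈ Ω, Q p.1 p.2 ≠ 0) :
    IsFlowOn Ω (fun t => rhoToV (Q t))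
      (fun t x => 1 / 2 * (h t x +
        (deriv (h t) x * Q t x - deriv (Q t) x * h t x) / Q t x ^ 2)) :=
  (H.add (H.deriv_snd.div H h0)).const_mul (1 / 2)

theorem IsFlowOn.comp_vToU (H : IsFlowOn Ω Q h) :
    IsFlowOn Ω (fun t => vToU (Q t)) (fun t x => deriv (h t) x - 2 * Q t x * h t x) :=
  H.deriv_snd.sub H.sq

theorem IsFlowOn.hasDerivAt_energy (H : IsFlowOn Ω Q h) {a b : ℝ} (hab : a ≤ b)
    (h0 : ∀ x ∈ Icc a b, ((0 : ℝ), x) ∈ Ω) :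
    HasDerivAt (fun s => energy a b (Q s)) (∫ x in a..b, 2 * Q 0 x * h 0 x) 0 :=
  H.sq.hasDerivAt_integral hab h0

end Substitutions

/-! ### Test functions -/

section Test

variable {f g k : ℝ → ℂ}

theorem IsTest.integrable (hf : IsTest f) : Integrable f :=
  hf.1.continuous.integrable_of_hasCompactSupport hf.2

theorem IsTest.deriv (hf : IsTest f) : IsTest (deriv f) := ⟨smooth_deriv hf.1, hf.2.deriv⟩

theorem IsTest.mul_left (hf : IsTest f) (hg : ContDiff ℝ ∞ g) : IsTest (fun x => g x * f x) :=
  ⟨hg.mul hf.1, hf.2.mul_left⟩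

theorem IsTest.mul_right (hf : IsTest f) (hg : ContDiff ℝ ∞ g) : IsTest (fun x => f x * g x) :=
  ⟨hf.1.mul hg, hf.2.mul_right⟩

theorem IsTest.const_mul (hf : IsTest f) (c : ℂ) : IsTest (fun x => c * f x) :=
  hf.mul_left contDiff_const

theorem IsTest.add (hf : IsTest f) (hg : IsTest g) : IsTest (fun x => f x + g x) :=
  ⟨hf.1.add hg.1, hf.2.add hg.2⟩

theorem IsTest.sub (hf : IsTest f) (hg : IsTest g) : IsTest (fun x => f x - g x) :=
  ⟨hf.1.sub hg.1, hf.2.sub hg.2⟩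

theorem IsTest.neg (hf : IsTest f) : IsTest (fun x => -f x) := by
  simpa using hf.const_mul (-1)

theorem IsTest.integral_deriv (hf : IsTest f) : ∫ x, _root_.deriv f x = 0 :=
  integral_eq_zero_of_hasDerivAt_of_integrable (hasDerivAt_of_smooth hf.1) hf.deriv.integrable
    hf.integrable

/-- Integrands that differ by a total derivative have the same integral. -/
theorem IsTest.integral_eq (hk : IsTest k) (hg : IsTest g)
    (h : ∀ x, HasDerivAt k (f x - g x) x) : ∫ x, f x = ∫ x, g x := by
  have e : f = fun x => _root_.deriv k x + g x := funext fun x => by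
    rw [(h x).deriv, sub_add_cancel]
  rw [e, integral_add hk.deriv.integrable hg.integrable, hk.integral_deriv, zero_add]

end Test

/-! ### Convolution with the sign function -/

/-- `∫ sign(x - y) k(y) dy`. -/
def sgnInt (k : ℝ → ℂ) (x : ℝ) : ℂ := ∫ y, sgn x y * k y

section SgnInt

variable {f g k l : ℝ → ℂ}

/-- The sign is 2·1_{y ≤ x} - 1 off the null set y = x. -/
theorem sgn_mul_ae_eq (k : ℝ → ℂ) (x : ℝ) :
    (fun y => 2 * (Iic x).indicator k y - k y) =ᵐ[volume] fun y => sgn x y * k y := by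
  have : ∀ᵐ y : ℝ, y ≠ x := compl_mem_ae_iff.2 (measure_singleton x)
  filter_upwards [this] with y hy
  rcases lt_or_gt_of_ne hy with h | h
  · rw [indicator_of_mem (mem_Iic.2 h.le), sgn, Real.sign_of_pos (sub_pos.2 h)]
    push_cast
    ring
  · rw [indicator_of_notMem (notMem_Iic.2 h), sgn, Real.sign_of_neg (sub_neg.2 h)]
    push_cast
    ring

theorem integrable_sgn_mul (hk : Integrable k) (x : ℝ) : Integrable fun y => sgn x y * k y :=
  (((hk.indicator measurableSet_Iic).const_mul 2).sub hk).congr (sgn_mul_ae_eq k x)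

theorem sgnInt_eq (hk : Integrable k) (x : ℝ) :
    sgnInt k x = 2 * (∫ y in Iic x, k y) - ∫ y, k y := by
  rw [sgnInt, ← integral_congr_ae (sgn_mul_ae_eq k x),
    integral_sub ((hk.indicator measurableSet_Iic).const_mul 2) hk, integral_const_mul,
    integral_indicator measurableSet_Iic]

theorem hasDerivAt_sgnInt (hk : IsTest k) (x : ℝ) : HasDerivAt (sgnInt k) (2 * k x) x := by
  have h1 : sgnInt k = fun x =>
      2 * ((∫ y in (0 : ℝ)..x, k y) + ∫ y in Iic 0, k y) - ∫ y, k y := by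
    funext x
    rw [sgnInt_eq hk.integrable, ← intervalIntegral.integral_Iic_sub_Iic
      hk.integrable.integrableOn hk.integrable.integrableOn, sub_add_cancel]
  rw [h1]
  exact (((hk.1.continuous.integral_hasStrictDerivAt 0 x).hasDerivAt.add_const _).const_mul
    2).sub_const _

theorem smooth_sgnInt (hk : IsTest k) : ContDiff ℝ ∞ (sgnInt k) := by
  rw [contDiff_infty_iff_deriv]
  refine ⟨fun x => (hasDerivAt_sgnInt hk x).differentiableAt, ?_⟩
  rw [funext fun x => (hasDerivAt_sgnInt hk x).deriv]
  exact contDiff_const.mul hk.1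

/-- The full integral of the derivative is zero by compact support, so only twice the integral up to
x survives. -/
theorem sgnInt_deriv (hk : IsTest k) (x : ℝ) : sgnInt (deriv k) x = 2 * k x := by
  rw [sgnInt_eq hk.deriv.integrable, hk.integral_deriv,
    HasCompactSupport.integral_Iic_deriv_eq (hk.1.of_le (by simp)) hk.2, sub_zero]

/-- Integration by parts against the sign: an exact derivative inside the integrand comes out as a
local term. This is the device that removes or matches the nonlocal terms below. -/
theorem sgnInt_eq_add (hk : IsTest k) (hg : IsTest g)
    (h : ∀ x, HasDerivAt k (f x - g x) x) (x : ℝ) : sgnInt f x = 2 * k x + sgnInt g x := by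
  rw [← sgnInt_deriv hk, sgnInt, sgnInt, sgnInt,
    ← integral_add (integrable_sgn_mul hk.deriv.integrable x) (integrable_sgn_mul hg.integrable x)]
  simp only [← mul_add, (h _).deriv, sub_add_cancel]

theorem sgnInt_const_mul (c : ℂ) (k : ℝ → ℂ) (x : ℝ) :
    sgnInt (fun y => c * k y) x = c * sgnInt k x := by
  simp only [sgnInt, ← integral_const_mul, mul_left_comm]

end SgnInt

/-! ### The nonlocal brackets through `sgnInt` -/

section Brackets

variable {η θ ρ E f : ℝ → ℂ}

/-- Expanding the square separates x from y, leaving the moments of f against 1, η and η². -/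
theorem etaPoisson_eq (hη : ContDiff ℝ ∞ η) (hf : IsTest f) (x : ℝ) :
    etaPoisson η f x = 1 / 2 * (η x ^ 2 * (∫ y, f y) - (∫ y, η y ^ 2 * f y) -
      (η x ^ 2 * sgnInt f x - 2 * η x * sgnInt (fun y => η y * f y) x +
        sgnInt (fun y => η y ^ 2 * f y) x)) := by
  have h1 := hf.mul_left hη
  have h2 := hf.mul_left (g := fun y => η y ^ 2) (hη.pow 2)
  have i0 := hf.integrable.const_mul (η x ^ 2)
  have i2 := h2.integrable
  have s0 := (integrable_sgn_mul hf.integrable x).const_mul (η x ^ 2)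
  have s1 := (integrable_sgn_mul h1.integrable x).const_mul (2 * η x)
  have s2 := integrable_sgn_mul i2 x
  have i02 : Integrable fun y => η x ^ 2 * f y - η y ^ 2 * f y := i0.sub i2
  have s01 : Integrable fun y =>
      η x ^ 2 * (sgn x y * f y) - 2 * η x * (sgn x y * (η y * f y)) := s0.sub s1
  have s012 : Integrable fun y => η x ^ 2 * (sgn x y * f y) -
      2 * η x * (sgn x y * (η y * f y)) + sgn x y * (η y ^ 2 * f y) := s01.add s2
  simp only [sgnInt]
  rw [← integral_const_mul, ← integral_const_mul, ← integral_const_mul, ← integral_sub i0 i2,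
    ← integral_sub s0 s1, ← integral_add s01 s2, ← integral_sub i02 s012,
    ← integral_const_mul, etaPoisson]
  refine integral_congr_ae (Eventually.of_forall fun y => ?_)
  ring

theorem thetaPoisson_eq (θ f : ℝ → ℂ) (x : ℝ) :
    thetaPoisson θ f x = θ x * sgnInt (fun y => θ y * f y) x := by
  rw [thetaPoisson, sgnInt, ← integral_const_mul]
  refine integral_congr_ae (Eventually.of_forall fun y => ?_)
  ring

theorem exp_integral_eq_div (hρ : Continuous ρ) (hE : ∀ x, HasDerivAt E (ρ x * E x) x)
    (hE0 : ∀ x, E x ≠ 0) (x y : ℝ) : Complex.exp (∫ s in x..y, ρ s) = E y / E x := by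
  -- Numerator and denominator solve the same linear equation y' = ρy, so their quotient is
  -- constant; compare z = y with z = x.
  have h1 : ∀ z, HasDerivAt (fun z => Complex.exp (∫ s in x..z, ρ s) / E z) 0 z := fun z => by
    have := (hρ.integral_hasStrictDerivAt x z).hasDerivAt.cexp.div (hE z) (hE0 z)
    refine this.congr_deriv ?_
    ring
  have h2 := is_const_of_deriv_eq_zero (fun z => (h1 z).differentiableAt)
    (fun z => (h1 z).deriv) y x
  simp only [intervalIntegral.integral_same, Complex.exp_zero] at h2
  have := hE0 x
  have := hE0 y
  field_simp at h2 ⊢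
  exact h2

/-- With I = ∫_x^y ρ, sinh I + σ cosh I = ½(e^I (1 + σ) + e^{-I} (σ - 1)), and e^I = E(y)/E(x)
separates the variables. -/
theorem rhoPoisson_eq (hρ : ContDiff ℝ ∞ ρ) (hEs : ContDiff ℝ ∞ E)
    (hE : ∀ x, HasDerivAt E (ρ x * E x) x) (hE0 : ∀ x, E x ≠ 0) (hf : IsTest f) (x : ℝ) :
    rhoPoisson ρ f x = ρ x * (1 / 2 *
      ((E x)⁻¹ * ((∫ y, E y * (ρ y * f y)) + sgnInt (fun y => E y * (ρ y * f y)) x) +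
        E x * (sgnInt (fun y => (E y)⁻¹ * (ρ y * f y)) x - ∫ y, (E y)⁻¹ * (ρ y * f y)))) := by
  have i1 := ((hf.mul_left hρ).mul_left hEs).integrable
  have i2 := ((hf.mul_left hρ).mul_left (g := fun y => (E y)⁻¹) (hEs.inv hE0)).integrable
  have s1 := integrable_sgn_mul i1 x
  have s2 := integrable_sgn_mul i2 x
  have t1 := (i1.add s1).const_mul (E x)⁻¹
  have t2 := (s2.sub i2).const_mul (E x)
  simp only [Pi.add_apply] at t1
  simp only [Pi.sub_apply] at t2
  simp only [sgnInt]
  rw [← integral_add i1 s1, ← integral_sub s2 i2, ← integral_const_mul, ← integral_const_mul,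
    ← integral_add t1 t2, ← integral_const_mul,
    ← integral_const_mul, rhoPoisson]
  refine integral_congr_ae (Eventually.of_forall fun y => ?_)
  simp only [Complex.sinh, Complex.cosh, Complex.exp_neg,
    exp_integral_eq_div hρ.continuous hE hE0]
  have := hE0 x
  have := hE0 y
  field_simp
  ring

/-- Every smooth function is a logarithmic derivative. -/
theorem exists_log_deriv_eq (hρ : ContDiff ℝ ∞ ρ) :
    ∃ E : ℝ → ℂ, ContDiff ℝ ∞ E ∧ (∀ x, HasDerivAt E (ρ x * E x) x) ∧ ∀ x, E x ≠ 0 := by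
  have hR : ∀ x, HasDerivAt (fun x => ∫ s in (0 : ℝ)..x, ρ s) (ρ x) x := fun x =>
    (hρ.continuous.integral_hasStrictDerivAt 0 x).hasDerivAt
  have hRs : ContDiff ℝ ∞ (fun x => ∫ s in (0 : ℝ)..x, ρ s) := by
    rw [contDiff_infty_iff_deriv]
    refine ⟨fun x => (hR x).differentiableAt, ?_⟩
    rwa [funext fun x => (hR x).deriv]
  refine ⟨fun x => Complex.exp (∫ s in (0 : ℝ)..x, ρ s), hRs.cexp, fun x => ?_,
    fun x => Complex.exp_ne_zero _⟩
  exact (hR x).cexp.congr_deriv (mul_comm _ _)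

end Brackets

/-! ### Criteria for Poisson maps -/

section PoissonMaps

variable {X Y Z : FieldSpace} {Φ Ψ : (ℝ → ℂ) → ℝ → ℂ}

/-- A substitution with linearization `L q` and formal adjoint `Ladj q` is Poisson if
`Y.poisson (Φ q) = L q ∘ X.poisson q ∘ Ladj q`. -/
theorem isPoissonMap_of_linearization (L Ladj : (ℝ → ℂ) → (ℝ → ℂ) → ℝ → ℂ)
    (hmaps : ∀ q ∈ X.carrier, Φ q ∈ Y.carrier)
    (hflow : ∀ Q h : ℝ → ℝ → ℂ, (∀ s, Q s ∈ X.carrier) → IsFlowOn univ Q h →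
      IsFlowOn univ (fun s => Φ (Q s)) (fun s => L (Q s) (h s)))
    (htest : ∀ q ∈ X.carrier, ∀ f, IsTest f → IsTest (Ladj q f))
    (hadj : ∀ q ∈ X.carrier, ∀ f h, IsTest f → ContDiff ℝ ∞ h →
      ∫ x, f x * L q h x = ∫ x, Ladj q f x * h x)
    (hsmooth : ∀ q ∈ X.carrier, ∀ g, IsTest g → ContDiff ℝ ∞ (X.poisson q g))
    (hpoisson : ∀ q ∈ X.carrier, ∀ g, IsTest g → ∀ x,
      Y.poisson (Φ q) g x = L q (X.poisson q (Ladj q g)) x) :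
    IsPoissonMap X Y Φ := by
  refine ⟨hmaps, ?_⟩
  have key : ∀ (F : (ℝ → ℂ) → ℂ) (q f : ℝ → ℂ), q ∈ X.carrier → Y.HasGradient F (Φ q) f →
      X.HasGradient (fun p => F (Φ p)) q (Ladj q f) := by
    intro F q f hq hF
    refine ⟨htest q hq f hF.1, ?_⟩
    rintro h Q ⟨hQ, hmem, hQ0, hd⟩
    -- A variation prescribes its velocity only at s = 0, whereas `hflow` needs it for every s;
    -- smoothness of h also comes from here.
    have H : IsFlowOn univ Q (fun s x => deriv (fun t => Q t x) s) := by
      refine ⟨isOpen_univ, hQ.contDiffOn, fun p _ => ?_⟩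
      have : ContDiff ℝ ∞ fun t => Q t p.2 :=
        hQ.comp (f := fun t : ℝ => (t, p.2)) (by fun_prop)
      exact hasDerivAt_of_smooth this p.1
    have hh : h = fun x => deriv (fun t => Q t x) 0 := funext fun x => (hd x).deriv.symm
    have hhs : ContDiff ℝ ∞ h := by
      rw [hh, ← contDiffOn_univ]
      have := smoothOn_slice (Q := fun s x => deriv (fun t => Q t x) s) H.smooth_velocity 0
      simpa only [mem_univ, ofPred_true] using this
    have K := hflow Q _ hmem H
    rw [← hadj q hq f h hF.1 hhs]
    refine hF.2 (L q h) (fun s => Φ (Q s)) ⟨contDiffOn_univ.1 K.smooth,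
      fun s => hmaps _ (hmem s), by simp only [hQ0], fun x => ?_⟩
    have := K.hasDerivAt (0, x) (mem_univ _)
    simpa only [hQ0, ← hh] using this
  rintro q hq F G c ⟨f, g, hf, hg, rfl⟩
  refine ⟨Ladj q f, Ladj q g, key F q f hq hf, key G q g hq hg, ?_⟩
  rw [← hadj q hq f _ hf.1 (hsmooth q hq _ (htest q hq g hg.1))]
  simp only [hpoisson q hq g hg.1]

theorem IsPoissonMap.comp (hΨ : IsPoissonMap Y Z Ψ) (hΦ : IsPoissonMap X Y Φ) :
    IsPoissonMap X Z (fun q => Ψ (Φ q)) :=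
  ⟨fun q hq => hΨ.1 _ (hΦ.1 q hq), fun q hq F G c h =>
    hΦ.2 q hq _ _ c (hΨ.2 _ (hΦ.1 q hq) F G c h)⟩

/-- Variations stay in the carrier, so the values of the map outside it never enter a gradient. -/
theorem IsPoissonMap.congr (hΦ : IsPoissonMap X Y Φ) (h : ∀ q ∈ X.carrier, Φ q = Ψ q) :
    IsPoissonMap X Y Ψ := by
  refine ⟨fun q hq => h q hq ▸ hΦ.1 q hq, fun q hq F G c hc => ?_⟩
  have key : ∀ (F : (ℝ → ℂ) → ℂ) (f : ℝ → ℂ), X.HasGradient (fun p => F (Φ p)) q f →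
      X.HasGradient (fun p => F (Ψ p)) q f := fun F f hF =>
    ⟨hF.1, fun k Q hQ => by simpa only [h _ (hQ.2.1 _)] using hF.2 k Q hQ⟩
  obtain ⟨f, g, hf, hg, e⟩ := hΦ.2 q hq F G c (by rwa [h q hq])
  exact ⟨f, g, key F f hf, key G g hg, e⟩

end PoissonMaps

/-! ### Commutativity of the diagram -/

section Diagram

variable {O : Set ℝ} {η : ℝ → ℂ}

theorem thetaToV_etaToTheta (η : ℝ → ℂ) : thetaToV (etaToTheta η) = etaToV η := by
  funext x
  rw [thetaToV, etaToV, iteratedDeriv_two]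
  rfl

theorem eqOn_rhoToV_etaToRho (hO : IsOpen O) (hη : ContDiffOn ℝ ∞ η O)
    (h1 : ∀ x ∈ O, deriv η x ≠ 0) (h0 : ∀ x ∈ O, η x ≠ 0) :
    EqOn (rhoToV (etaToRho η)) (etaToV η) O := by
  intro x hx
  have hd := (hasDerivAt_of_smoothOn hO (smoothOn_deriv hO hη) hx).div
    (hasDerivAt_of_smoothOn hO hη hx) (h0 x hx)
  have hd' : deriv (etaToRho η) x = _ := hd.deriv
  have := h0 x hx
  have := h1 x hx
  rw [rhoToV, hd', etaToV, iteratedDeriv_two, etaToRho]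
  field_simp
  ring

theorem eqOn_vToU_etaToV (hO : IsOpen O) (hη : ContDiffOn ℝ ∞ η O)
    (h1 : ∀ x ∈ O, deriv η x ≠ 0) : EqOn (vToU (etaToV η)) (etaToU η) O := by
  intro x hx
  have hη1 := smoothOn_deriv hO hη
  have hd := ((hasDerivAt_of_smoothOn hO (smoothOn_deriv hO hη1) hx).div
    (hasDerivAt_of_smoothOn hO hη1 hx) (h1 x hx)).const_mul (1 / 2)
  have hd' : deriv (thetaToV (etaToTheta η)) x = _ := hd.deriv
  have := h1 x hx
  rw [vToU, ← thetaToV_etaToTheta, hd', thetaToV_etaToTheta, etaToU, schwarzian, etaToV,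
    iteratedDeriv_two, iteratedDeriv_three]
  field_simp
  ring

theorem rhoToV_etaToRho {η : ℝ → ℂ} (hη : η ∈ etaSpaceStar.carrier) :
    rhoToV (etaToRho η) = etaToV η := funext fun x =>
  eqOn_rhoToV_etaToRho isOpen_univ hη.1.contDiffOn (fun y _ => hη.2.1 y) (fun y _ => hη.2.2 y)
    (mem_univ x)

theorem vToU_etaToV {η : ℝ → ℂ} (hη : η ∈ etaSpace.carrier) :
    vToU (etaToV η) = etaToU η := funext fun x =>
  eqOn_vToU_etaToV isOpen_univ hη.1.contDiffOn (fun y _ => hη.2 y) (mem_univ x)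

end Diagram

/-! ### The maps of the diagram are Poisson -/

section Brackets

variable {η θ ρ v f : ℝ → ℂ}

theorem smooth_etaPoisson (hη : ContDiff ℝ ∞ η) (hf : IsTest f) :
    ContDiff ℝ ∞ (etaPoisson η f) := by
  rw [funext (etaPoisson_eq hη hf)]
  exact contDiff_const.mul ((((hη.pow 2).mul contDiff_const).sub contDiff_const).sub
    ((((hη.pow 2).mul (smooth_sgnInt hf)).sub
      ((contDiff_const.mul hη).mul (smooth_sgnInt (hf.mul_left hη)))).add
        (smooth_sgnInt (hf.mul_left (g := fun y => η y ^ 2) (hη.pow 2)))))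

/-- The sign is multiplied by (η(x) - η(y))², which vanishes on the diagonal; hence the local terms
from differentiating the three sign integrals cancel. -/
theorem hasDerivAt_etaPoisson (hη : ContDiff ℝ ∞ η) (hf : IsTest f) (x : ℝ) :
    HasDerivAt (etaPoisson η f)
      (deriv η x * (η x * (∫ y, f y) - η x * sgnInt f x + sgnInt (fun y => η y * f y) x)) x := by
  rw [funext (etaPoisson_eq hη hf)]
  have hd := hasDerivAt_of_smooth hη x
  have h0 := hasDerivAt_sgnInt hf x
  have h1 := hasDerivAt_sgnInt (hf.mul_left hη) x
  have h2 := hasDerivAt_sgnInt (hf.mul_left (g := fun y => η y ^ 2) (hη.pow 2)) x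
  refine (((((hd.pow 2).mul_const _).sub_const _).sub
    ((((hd.pow 2).mul h0).sub ((hd.const_mul 2).mul h1)).add h2)).const_mul
      (1 / 2)).congr_deriv ?_
  simp only [Pi.pow_apply]
  push_cast
  ring

theorem smooth_thetaPoisson (hθ : ContDiff ℝ ∞ θ) (hf : IsTest f) :
    ContDiff ℝ ∞ (thetaPoisson θ f) := by
  rw [funext (thetaPoisson_eq θ f)]
  exact hθ.mul (smooth_sgnInt (hf.mul_left hθ))

theorem smooth_rhoPoisson (hρ : ContDiff ℝ ∞ ρ) (hf : IsTest f) :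
    ContDiff ℝ ∞ (rhoPoisson ρ f) := by
  obtain ⟨E, hEs, hE, hE0⟩ := exists_log_deriv_eq hρ
  have hEi : ContDiff ℝ ∞ fun x => (E x)⁻¹ := hEs.inv hE0
  rw [funext (rhoPoisson_eq hρ hEs hE hE0 hf)]
  exact hρ.mul (contDiff_const.mul
    ((hEi.mul (contDiff_const.add (smooth_sgnInt ((hf.mul_left hρ).mul_left hEs)))).add
      (hEs.mul ((smooth_sgnInt ((hf.mul_left hρ).mul_left hEi)).sub contDiff_const))))

end Brackets

/-- In kernel form, ∂_x∂_y kills η(x)² - η(y)² and turns the sign term into sign(x - y) η'(x) η'(y).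
-/
theorem isPoissonMap_etaToTheta : IsPoissonMap etaSpace thetaSpace etaToTheta := by
  refine isPoissonMap_of_linearization (fun _ h => deriv h) (fun _ g x => -deriv g x)
    (fun q hq => ⟨smooth_deriv hq.1, hq.2⟩) (fun Q h _ H => H.deriv_snd)
    (fun q _ f hf => hf.deriv.neg) ?_ (fun q hq g hg => smooth_etaPoisson hq.1 hg) ?_
  · intro q _ f h hf hh
    refine (hf.mul_left hh).integral_eq (hf.deriv.neg.mul_right hh) fun x => ?_
    exact ((hasDerivAt_of_smooth hh x).mul (hasDerivAt_of_smooth hf.1 x)).congr_deriv (by ring)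
  · intro q hq g hg x
    have hθ : ContDiff ℝ ∞ (deriv q) := smooth_deriv hq.1
    change thetaPoisson (deriv q) g x = deriv (etaPoisson q _) x
    have hC : ∫ y, -deriv g y = 0 := by rw [integral_neg, hg.integral_deriv, neg_zero]
    have hS0 : sgnInt (fun y => -deriv g y) x = -2 * g x := by
      have := sgnInt_const_mul (-1) (deriv g) x
      rw [sgnInt_deriv hg] at this
      simpa using this
    have hS1 : sgnInt (fun y => q y * -deriv g y) x =
        2 * (-1 * (q x * g x)) + sgnInt (fun y => deriv q y * g y) x := by
      refine sgnInt_eq_add ((hg.mul_left hq.1).const_mul (-1)) (hg.mul_left hθ)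
        (fun y => ?_) x
      exact (((hasDerivAt_of_smooth hq.1 y).mul (hasDerivAt_of_smooth hg.1 y)).const_mul
        (-1)).congr_deriv (by ring)
    rw [(hasDerivAt_etaPoisson hq.1 hg.deriv.neg x).deriv, hC, hS0, hS1, thetaPoisson_eq]
    ring

/-- Since v = ½(log θ)', the linearization is h ↦ ½(h/θ)'. The adjoint makes the sign integrand
exact, so J L*g = -θg is already local. -/
theorem isPoissonMap_thetaToV : IsPoissonMap thetaSpace vSpace thetaToV := by
  refine isPoissonMap_of_linearization
    (fun q h x => 1 / 2 * ((deriv h x * q x - deriv q x * h x) / q x ^ 2))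
    (fun q g x => -(1 / 2) * (q x)⁻¹ * deriv g x)
    (fun q hq => contDiff_const.mul (smooth_div (smooth_deriv hq.1) hq.1 hq.2))
    (fun Q h hQ H => H.comp_thetaToV fun p _ => (hQ p.1).2 p.2)
    (fun q hq f hf => hf.deriv.mul_left (contDiff_const.mul (hq.1.inv hq.2))) ?_
    (fun q hq g hg => smooth_thetaPoisson hq.1 hg) ?_
  · intro q hq f h hf hh
    have hqi : ContDiff ℝ ∞ fun x => (q x)⁻¹ := hq.1.inv hq.2
    refine (hf.mul_left ((contDiff_const (c := (1 / 2 : ℂ))).mul (hh.mul hqi))).integral_eq ?_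
      fun x => ?_
    · exact (hf.deriv.mul_left ((contDiff_const (c := (-(1 / 2) : ℂ))).mul hqi)).mul_right hh
    · have := hq.2 x
      refine ((((hasDerivAt_of_smooth hh x).mul ((hasDerivAt_of_smooth hq.1 x).inv this)).const_mul
        (1 / 2)).mul (hasDerivAt_of_smooth hf.1 x)).congr_deriv ?_
      simp only [Pi.mul_apply, Pi.inv_apply]
      field_simp
      ring
  · intro q hq g hg x
    have h1 : thetaPoisson q (fun x => -(1 / 2) * (q x)⁻¹ * deriv g x) = fun x => -(q x * g x) := by
      funext y
      rw [thetaPoisson_eq]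
      have : (fun z => q z * (-(1 / 2) * (q z)⁻¹ * deriv g z)) = fun z => -(1 / 2) * deriv g z := by
        funext z
        have := hq.2 z
        field_simp
      rw [this, sgnInt_const_mul, sgnInt_deriv hg]
      ring
    change vPoisson (thetaToV q) g x = 1 / 2 * ((deriv (thetaPoisson q _) x * q x -
      deriv q x * thetaPoisson q _ x) / q x ^ 2)
    have h2 : HasDerivAt (fun x => -(q x * g x)) _ x :=
      ((hasDerivAt_of_smooth hq.1 x).mul (hasDerivAt_of_smooth hg.1 x)).neg
    rw [h1, h2.deriv, vPoisson]
    have := hq.2 x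
    field_simp
    ring

/-- The Miura factorization: (∂ - 2v)(-½∂)(-∂ - 2v) = ½∂³ + u∂ + ∂u. -/
theorem isPoissonMap_vToU : IsPoissonMap vSpace uSpace vToU := by
  refine isPoissonMap_of_linearization
    (fun q h x => deriv h x - 2 * q x * h x) (fun q g x => -deriv g x - 2 * q x * g x)
    (fun q (hq : ContDiff ℝ ∞ q) => (smooth_deriv hq).sub (hq.pow 2))
    (fun Q h hQ H => H.comp_vToU)
    (fun q hq f hf => hf.deriv.neg.sub (hf.mul_left (contDiff_const.mul hq))) ?_
    (fun q hq g hg => contDiff_const.mul (smooth_deriv hg.1)) ?_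
  · intro q hq f h hf hh
    refine (hf.mul_left hh).integral_eq ?_ fun x => ?_
    · exact (hf.deriv.neg.sub (hf.mul_left (contDiff_const.mul hq))).mul_right hh
    · exact ((hasDerivAt_of_smooth hh x).mul (hasDerivAt_of_smooth hf.1 x)).congr_deriv (by ring)
  · intro q (hq : ContDiff ℝ ∞ q) g hg x
    have q0 := hasDerivAt_of_smooth hq
    have q1 := hasDerivAt_of_smooth (smooth_deriv hq)
    have g0 := hasDerivAt_of_smooth hg.1
    have g1 := hasDerivAt_of_smooth (smooth_deriv hg.1)
    have g2 := hasDerivAt_of_smooth (smooth_deriv (smooth_deriv hg.1))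
    have e1 : ∀ x, HasDerivAt (fun x => -deriv g x - 2 * q x * g x)
        (-deriv (deriv g) x - (2 * deriv q x * g x + 2 * q x * deriv g x)) x := fun x =>
      (g1 x).neg.sub (((q0 x).const_mul 2).mul (g0 x))
    have e2 : ∀ x, vPoisson q (fun x => -deriv g x - 2 * q x * g x) x = -(1 / 2) *
        (-deriv (deriv g) x - (2 * deriv q x * g x + 2 * q x * deriv g x)) := fun x => by
      rw [vPoisson, (e1 x).deriv]
    have e3 := ((g2 x).neg.sub (((((q1 x).const_mul 2).mul (g0 x))).add
      (((q0 x).const_mul 2).mul (g1 x)))).const_mul (-(1 / 2))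
    have e4 : HasDerivAt (fun x => vToU q x * g x) _ x := ((q1 x).sub ((q0 x).pow 2)).mul (g0 x)
    have e5 : deriv (fun x => -(1 / 2) *
        (-deriv (deriv g) x - (2 * deriv q x * g x + 2 * q x * deriv g x))) x = _ := e3.deriv
    change 1 / 2 * iteratedDeriv 3 g x + vToU q x * deriv g x + deriv (fun x => vToU q x * g x) x =
      deriv (vPoisson q fun x => -deriv g x - 2 * q x * g x) x -
        2 * q x * vPoisson q (fun x => -deriv g x - 2 * q x * g x) x
    rw [funext e2, e5, e4.deriv, iteratedDeriv_three, vToU]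
    simp only [Pi.sub_apply, Pi.pow_apply]
    push_cast
    ring

theorem isPoissonMap_rhoToV : IsPoissonMap rhoSpace vSpace rhoToV := by
  refine isPoissonMap_of_linearization
    (fun q h x => 1 / 2 * (h x + (deriv h x * q x - deriv q x * h x) / q x ^ 2))
    (fun q g x => 1 / 2 * (g x - (q x)⁻¹ * deriv g x))
    (fun q hq => contDiff_const.mul (hq.1.add (smooth_div (smooth_deriv hq.1) hq.1 hq.2)))
    (fun Q h hQ H => H.comp_rhoToV fun p _ => (hQ p.1).2 p.2)
    (fun q hq f hf => (hf.sub (hf.deriv.mul_left (hq.1.inv hq.2))).const_mul _) ?_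
    (fun q hq g hg => smooth_rhoPoisson hq.1 hg) ?_
  · intro q hq f h hf hh
    have hqi : ContDiff ℝ ∞ fun x => (q x)⁻¹ := hq.1.inv hq.2
    refine (hf.mul_left ((contDiff_const (c := (1 / 2 : ℂ))).mul (hh.mul hqi))).integral_eq ?_
      fun x => ?_
    · exact ((hf.sub (hf.deriv.mul_left (hq.1.inv hq.2))).const_mul (1 / 2)).mul_right hh
    · have := hq.2 x
      refine ((((hasDerivAt_of_smooth hh x).mul ((hasDerivAt_of_smooth hq.1 x).inv this)).const_mul
        (1 / 2)).mul (hasDerivAt_of_smooth hf.1 x)).congr_deriv ?_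
      simp only [Pi.mul_apply, Pi.inv_apply]
      field_simp
      ring
  · intro q hq g hg x
    obtain ⟨E, hEs, hE, hE0⟩ := exists_log_deriv_eq hq.1
    have hEi : ContDiff ℝ ∞ fun x => (E x)⁻¹ := hEs.inv hE0
    set f : ℝ → ℂ := fun x => 1 / 2 * (g x - (q x)⁻¹ * deriv g x) with hfdef
    have hf : IsTest f := (hg.sub (hg.deriv.mul_left (hq.1.inv hq.2))).const_mul _
    have hk : IsTest fun y => -(1 / 2) * (E y)⁻¹ * g y := hg.mul_left (contDiff_const.mul hEi)
    -- One exponential half of the bracket has an exact integrand, so it collapses to the local term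
    -- -g in `e2`. The other half, ρE⁻¹(A + S), satisfies (h/ρ)' = -h plus a local term, so L
    -- removes its nonlocal part; A and S can therefore be generalized at the end.
    have e1 : (fun y => (E y)⁻¹ * (q y * f y)) = deriv fun y => -(1 / 2) * (E y)⁻¹ * g y := by
      funext y
      have := (((hE y).inv (hE0 y)).const_mul (-(1 / 2))).mul (hasDerivAt_of_smooth hg.1 y)
      refine Eq.trans ?_ this.deriv.symm
      have := hE0 y
      have := hq.2 y
      simp only [hfdef, Pi.inv_apply]
      field_simp
      ring
    have hA := hasDerivAt_sgnInt ((hf.mul_left hq.1).mul_left hEs) x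
    have e2 : rhoPoisson q f = fun x => q x * (1 / 2 * ((E x)⁻¹ *
        ((∫ y, E y * (q y * f y)) + sgnInt (fun y => E y * (q y * f y)) x) - g x)) := by
      funext x
      have := hE0 x
      rw [rhoPoisson_eq hq.1 hEs hE hE0 hf, e1, hk.integral_deriv, sgnInt_deriv hk]
      field_simp
      ring
    have e3 := (hasDerivAt_of_smooth hq.1 x).mul (((((hE x).inv (hE0 x)).mul
      (hA.const_add (∫ y, E y * (q y * f y)))).sub (hasDerivAt_of_smooth hg.1 x)).const_mul (1 / 2))
    have e4 : deriv (fun x => q x * (1 / 2 * ((E x)⁻¹ * ((∫ y, E y * (q y * f y)) +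
        sgnInt (fun y => E y * (q y * f y)) x) - g x))) x = _ := e3.deriv
    change vPoisson (rhoToV q) g x = 1 / 2 * (rhoPoisson q f x + (deriv (rhoPoisson q f) x * q x -
      deriv q x * rhoPoisson q f x) / q x ^ 2)
    rw [e2, e4, vPoisson]
    have h1 := hE0 x
    have h2 := hq.2 x
    have h3 : f x = 1 / 2 * (g x - (q x)⁻¹ * deriv g x) := rfl
    simp only [Pi.inv_apply, Pi.mul_apply, Pi.sub_apply, h3]
    generalize (∫ y, E y * (q y * f y)) = A
    generalize sgnInt (fun y => E y * (q y * f y)) x = S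
    field_simp
    ring

theorem isPoissonMap_etaToRho : IsPoissonMap etaSpaceStar rhoSpace etaToRho := by
  have hLadj : ∀ q ∈ etaSpaceStar.carrier, ∀ f, IsTest f →
      IsTest fun x => -(q x)⁻¹ * deriv f x := fun q hq f hf =>
    hf.deriv.mul_left (hq.1.inv hq.2.2).neg
  refine isPoissonMap_of_linearization
    (fun q h x => (deriv h x * q x - deriv q x * h x) / q x ^ 2)
    (fun q g x => -(q x)⁻¹ * deriv g x)
    (fun q hq => ⟨smooth_div (smooth_deriv hq.1) hq.1 hq.2.2,
      fun x => div_ne_zero (hq.2.1 x) (hq.2.2 x)⟩)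
    (fun Q h hQ H => H.comp_etaToRho fun p _ => (hQ p.1).2.2 p.2) hLadj ?_
    (fun q hq g hg => smooth_etaPoisson hq.1 hg) ?_
  · intro q hq f h hf hh
    have hqi : ContDiff ℝ ∞ fun x => (q x)⁻¹ := hq.1.inv hq.2.2
    refine (hf.mul_left (hh.mul hqi)).integral_eq ?_ fun x => ?_
    · exact (hLadj q hq f hf).mul_right hh
    · have := hq.2.2 x
      refine (((hasDerivAt_of_smooth hh x).mul ((hasDerivAt_of_smooth hq.1 x).inv this)).mul
        (hasDerivAt_of_smooth hf.1 x)).congr_deriv ?_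
      simp only [Pi.mul_apply, Pi.inv_apply]
      field_simp
      ring
  · intro q hq g hg x
    have hθ := smooth_deriv hq.1
    have hqi : ContDiff ℝ ∞ fun x => (q x)⁻¹ := hq.1.inv hq.2.2
    have hρ : ContDiff ℝ ∞ (etaToRho q) := smooth_div hθ hq.1 hq.2.2
    -- The curve itself serves as E, since η' = ρη. With `e1` and `e2` the moments of L*g against η²
    -- and 1 reduce to those in `rhoPoisson_eq`; the moment against η cancels in (h/η)'.
    have hE : ∀ y, HasDerivAt q (etaToRho q y * q y) y := fun y => by
      rw [etaToRho, div_mul_cancel₀ _ (hq.2.2 y)]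
      exact hasDerivAt_of_smooth hq.1 y
    have h1 : IsTest fun y => q y * (etaToRho q y * g y) := (hg.mul_left hρ).mul_left hq.1
    have h2 : IsTest fun y => (q y)⁻¹ * (etaToRho q y * g y) := (hg.mul_left hρ).mul_left hqi
    have k1 : IsTest fun y => -1 * (q y * g y) := (hg.mul_left hq.1).const_mul _
    have k2 : IsTest fun y => -1 * ((q y)⁻¹ * g y) := (hg.mul_left hqi).const_mul _
    have e1 : ∀ y, HasDerivAt (fun y => -1 * (q y * g y))
        (q y ^ 2 * (-(q y)⁻¹ * deriv g y) - q y * (etaToRho q y * g y)) y := fun y => by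
      refine (((hasDerivAt_of_smooth hq.1 y).mul (hasDerivAt_of_smooth hg.1 y)).const_mul
        (-1)).congr_deriv ?_
      have := hq.2.2 y
      rw [etaToRho]
      field_simp
      ring
    have e2 : ∀ y, HasDerivAt (fun y => -1 * ((q y)⁻¹ * g y))
        (-(q y)⁻¹ * deriv g y - -1 * ((q y)⁻¹ * (etaToRho q y * g y))) y := fun y => by
      refine ((((hasDerivAt_of_smooth hq.1 y).inv (hq.2.2 y)).mul
        (hasDerivAt_of_smooth hg.1 y)).const_mul (-1)).congr_deriv ?_
      have := hq.2.2 y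
      rw [etaToRho, Pi.inv_apply]
      field_simp
      ring
    have hf := hLadj q hq g hg
    change rhoPoisson (etaToRho q) g x = (deriv (etaPoisson q _) x * q x -
      deriv q x * etaPoisson q _ x) / q x ^ 2
    rw [rhoPoisson_eq hρ hq.1 hE hq.2.2 hg, (hasDerivAt_etaPoisson hq.1 hf x).deriv,
      etaPoisson_eq hq.1 hf, k1.integral_eq h1 e1, k2.integral_eq (h2.const_mul _) e2,
      sgnInt_eq_add k1 h1 e1, sgnInt_eq_add k2 (h2.const_mul _) e2,
      sgnInt_const_mul, integral_const_mul]
    have h3 : etaToRho q x = deriv q x / q x := rfl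
    rw [h3]
    generalize (∫ y, q y * (etaToRho q y * g y)) = A
    generalize (∫ y, (q y)⁻¹ * (etaToRho q y * g y)) = B
    generalize sgnInt (fun y => q y * (etaToRho q y * g y)) x = S
    generalize sgnInt (fun y => (q y)⁻¹ * (etaToRho q y * g y)) x = T
    have := hq.2.2 x
    field_simp
    ring

theorem isPoissonMap_etaToV : IsPoissonMap etaSpace vSpace etaToV :=
  (isPoissonMap_thetaToV.comp isPoissonMap_etaToTheta).congr fun q _ => thetaToV_etaToTheta q

theorem isPoissonMap_etaToU : IsPoissonMap etaSpace uSpace etaToU :=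
  (isPoissonMap_vToU.comp isPoissonMap_etaToV).congr fun _ hq => vToU_etaToV hq

/-! ### Divergence forms of the equations

On each level the right-hand side of the equation is expressed through the field and
the field `u` that it defines. -/

section DivergenceForms

variable {O : Set ℝ} {η θ ρ v v₁ v₂ : ℝ → ℂ}

theorem smoothOn_div {f g : ℝ → ℂ} (hf : ContDiffOn ℝ ∞ f O) (hg : ContDiffOn ℝ ∞ g O)
    (h0 : ∀ x ∈ O, g x ≠ 0) : ContDiffOn ℝ ∞ (fun x => f x / g x) O := by
  simp only [div_eq_mul_inv]
  exact hf.mul (hg.inv h0)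

theorem smoothOn_vToU (hO : IsOpen O) (hv : ContDiffOn ℝ ∞ v O) : ContDiffOn ℝ ∞ (vToU v) O :=
  (smoothOn_deriv hO hv).sub (hv.pow 2)

theorem smoothOn_thetaToV (hO : IsOpen O) (hθ : ContDiffOn ℝ ∞ θ O) (h0 : ∀ x ∈ O, θ x ≠ 0) :
    ContDiffOn ℝ ∞ (thetaToV θ) O :=
  contDiffOn_const.mul (smoothOn_div (smoothOn_deriv hO hθ) hθ h0)

theorem smoothOn_rhoToV (hO : IsOpen O) (hρ : ContDiffOn ℝ ∞ ρ O) (h0 : ∀ x ∈ O, ρ x ≠ 0) :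
    ContDiffOn ℝ ∞ (rhoToV ρ) O :=
  contDiffOn_const.mul (hρ.add (smoothOn_div (smoothOn_deriv hO hρ) hρ h0))

theorem eqOn_vToU (hO : IsOpen O) (h : EqOn v₁ v₂ O) : EqOn (vToU v₁) (vToU v₂) O := fun x hx => by
  rw [vToU, vToU, eqOn_deriv hO h hx, h hx]

theorem eqOn_uFlow (hO : IsOpen O) (h : EqOn v₁ v₂ O) : EqOn (uFlow v₁) (uFlow v₂) O :=
  fun x hx => by
    rw [uFlow, uFlow, iteratedDeriv_three, iteratedDeriv_three, h hx, eqOn_deriv hO h hx,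
      eqOn_deriv hO (eqOn_deriv hO (eqOn_deriv hO h)) hx]

theorem eqOn_deriv_vToU (hO : IsOpen O) (hv : ContDiffOn ℝ ∞ v O) :
    EqOn (deriv (vToU v)) (fun x => deriv (deriv v) x - 2 * v x * deriv v x) O := by
  refine eqOn_deriv_of_hasDerivAt hO (eqOn_refl _ _) fun y hy => ?_
  refine ((hasDerivAt_of_smoothOn hO (smoothOn_deriv hO hv) hy).sub
    ((hasDerivAt_of_smoothOn hO hv hy).pow 2)).congr_deriv ?_
  push_cast
  ring

theorem eqOn_vFlow (hO : IsOpen O) (hv : ContDiffOn ℝ ∞ v O) :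
    EqOn (vFlow v) (fun x => deriv (deriv (vToU v)) x +
      2 * (deriv v x * vToU v x + v x * deriv (vToU v) x)) O := by
  intro x hx
  have hv1 := smoothOn_deriv hO hv
  have h2 : deriv (deriv (vToU v)) x = deriv (deriv (deriv v)) x -
      (2 * deriv v x * deriv v x + 2 * v x * deriv (deriv v) x) :=
    eqOn_deriv_of_hasDerivAt hO (eqOn_deriv_vToU hO hv) (fun y hy =>
      (hasDerivAt_of_smoothOn hO (smoothOn_deriv hO hv1) hy).sub
        (((hasDerivAt_of_smoothOn hO hv hy).const_mul 2).mul
          (hasDerivAt_of_smoothOn hO hv1 hy))) hx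
  simp only [h2, eqOn_deriv_vToU hO hv hx, vFlow, iteratedDeriv_three, vToU]
  ring

theorem deriv_eq_thetaToV_mul (h0 : ∀ x ∈ O, θ x ≠ 0) :
    EqOn (deriv θ) (fun x => 2 * thetaToV θ x * θ x) O := fun x hx => by
  have := h0 x hx
  simp only [thetaToV]
  field_simp

theorem eqOn_thetaFlow (hO : IsOpen O) (hθ : ContDiffOn ℝ ∞ θ O) (h0 : ∀ x ∈ O, θ x ≠ 0) :
    EqOn (thetaFlow θ) (fun x => θ x * (2 * deriv (vToU (thetaToV θ)) x +
      4 * vToU (thetaToV θ) x * thetaToV θ x)) O := by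
  intro x hx
  have hv := smoothOn_thetaToV hO hθ h0
  have e1 := deriv_eq_thetaToV_mul h0
  have dθ : ∀ y ∈ O, HasDerivAt θ (2 * thetaToV θ y * θ y) y := fun y hy => by
    have := hasDerivAt_of_smoothOn hO hθ hy
    rwa [e1 hy] at this
  have e4 : EqOn (fun y => deriv θ y ^ 2 / θ y) (fun y => 4 * thetaToV θ y ^ 2 * θ y) O :=
    fun y hy => by
      have := h0 y hy
      simp only [e1 hy]
      field_simp
      ring
  revert hx x
  -- From here only θ' = 2vθ is used: each derivative of θ is θ times a differential polynomial in
  -- v.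
  generalize thetaToV θ = v at *
  have hv1 := smoothOn_deriv hO hv
  intro x hx
  have dv := fun y (hy : y ∈ O) => hasDerivAt_of_smoothOn hO hv hy
  have dv1 := fun y (hy : y ∈ O) => hasDerivAt_of_smoothOn hO hv1 hy
  have e2 := eqOn_deriv_of_hasDerivAt hO e1 fun y hy => ((dv y hy).const_mul 2).mul (dθ y hy)
  have e3 := eqOn_deriv_of_hasDerivAt hO e2 (fun y hy =>
    (((dv1 y hy).const_mul 2).mul (dθ y hy)).add
      (((dv y hy).const_mul 2).mul (((dv y hy).const_mul 2).mul (dθ y hy)))) hx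
  have e5 := eqOn_deriv_of_hasDerivAt hO e4 (fun y hy =>
    (((dv y hy).pow 2).const_mul 4).mul (dθ y hy)) hx
  simp only [thetaFlow, iteratedDeriv_three, e3, e5, eqOn_deriv_vToU hO hv hx, vToU,
    Pi.pow_apply]
  push_cast
  ring

theorem deriv_rhoToV (hO : IsOpen O) (hρ : ContDiffOn ℝ ∞ ρ O) (h0 : ∀ x ∈ O, ρ x ≠ 0) :
    EqOn (deriv (rhoToV ρ)) (fun x => 1 / 2 * (deriv ρ x +
      (deriv (deriv ρ) x * ρ x - deriv ρ x * deriv ρ x) / ρ x ^ 2)) O := fun x hx =>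
  (((hasDerivAt_of_smoothOn hO hρ hx).add
    ((hasDerivAt_of_smoothOn hO (smoothOn_deriv hO hρ) hx).div
      (hasDerivAt_of_smoothOn hO hρ hx) (h0 x hx))).const_mul (1 / 2)).deriv

/-- Already before differentiation, 2uρ = ρ'' - (3/2)ρ'²/ρ - ½ρ³; the equation is the x-derivative
of this identity. -/
theorem eqOn_rhoFlow (hO : IsOpen O) (hρ : ContDiffOn ℝ ∞ ρ O) (h0 : ∀ x ∈ O, ρ x ≠ 0) :
    EqOn (rhoFlow ρ) (fun x => 2 * (deriv (vToU (rhoToV ρ)) x * ρ x +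
      vToU (rhoToV ρ) x * deriv ρ x)) O := by
  intro x hx
  have hu := smoothOn_vToU hO (smoothOn_rhoToV hO hρ h0)
  have hρ1 := smoothOn_deriv hO hρ
  have e1 : EqOn (fun y => 2 * (vToU (rhoToV ρ) y * ρ y)) (fun y => deriv (deriv ρ) y -
      3 / 2 * (deriv ρ y ^ 2 / ρ y) - 1 / 2 * ρ y ^ 3) O := fun y hy => by
    have := h0 y hy
    simp only [vToU, deriv_rhoToV hO hρ h0 hy, rhoToV]
    field_simp
    ring
  have d1 : HasDerivAt (fun y => 2 * (vToU (rhoToV ρ) y * ρ y)) _ x :=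
    ((hasDerivAt_of_smoothOn hO hu hx).mul (hasDerivAt_of_smoothOn hO hρ hx)).const_mul 2
  have d2 := ((hasDerivAt_of_smoothOn hO (smoothOn_deriv hO hρ1) hx).sub
    ((hasDerivAt_of_smoothOn hO (smoothOn_div (hρ1.pow 2) hρ h0) hx).const_mul (3 / 2))).sub
    ((hasDerivAt_of_smoothOn hO (hρ.pow 3) hx).const_mul (1 / 2))
  rw [rhoFlow, iteratedDeriv_three]
  simp only
  rw [← d1.deriv, eqOn_deriv hO e1 hx]
  exact d2.deriv.symm

theorem etaFlow_eq (η : ℝ → ℂ) (x : ℝ) : etaFlow η x = 2 * etaToU η x * deriv η x := by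
  rw [etaFlow, etaToU]
  ring

end DivergenceForms

/-! ### The substitutions map solutions to solutions -/

section Solutions

variable {Ω : Set (ℝ × ℝ)} {η θ ρ v : ℝ → ℝ → ℂ}

theorem IsSolutionOn.comp_vToU (hΩ : IsOpen Ω) (H : IsSolutionOn Ω vFlow v) :
    IsSolutionOn Ω uFlow (fun t => vToU (v t)) := by
  refine (H.isFlowOn hΩ).comp_vToU.isSolutionOn fun p hp => ?_
  have hO := isOpen_slice hΩ p.1
  have hx : p.2 ∈ {x | (p.1, x) ∈ Ω} := hp
  have hv := smoothOn_slice H.1 p.1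
  have hu := smoothOn_vToU hO hv
  have hu1 := smoothOn_deriv hO hu
  have e := eqOn_deriv_of_hasDerivAt hO (eqOn_vFlow hO hv) (fun y hy =>
    (hasDerivAt_of_smoothOn hO (smoothOn_deriv hO hu1) hy).add
      ((((hasDerivAt_of_smoothOn hO (smoothOn_deriv hO hv) hy).mul
        (hasDerivAt_of_smoothOn hO hu hy)).add ((hasDerivAt_of_smoothOn hO hv hy).mul
          (hasDerivAt_of_smoothOn hO hu1 hy))).const_mul 2)) hx
  -- Applying ∂ - 2v to (u' + 2uv)' leaves u''' + 2u(v'' - 2vv') + 4u'(v' - v²), and the two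
  -- brackets are u' and u.
  rw [e, eqOn_vFlow hO hv hx, uFlow, iteratedDeriv_three]
  simp only [eqOn_deriv_vToU hO hv hx, vToU]
  ring

theorem IsSolutionOn.comp_thetaToV (hΩ : IsOpen Ω) (h0 : ∀ p ∈ Ω, θ p.1 p.2 ≠ 0)
    (H : IsSolutionOn Ω thetaFlow θ) : IsSolutionOn Ω vFlow (fun t => thetaToV (θ t)) := by
  refine ((H.isFlowOn hΩ).comp_thetaToV h0).isSolutionOn fun p hp => ?_
  have hO := isOpen_slice hΩ p.1
  have hx : p.2 ∈ {x | (p.1, x) ∈ Ω} := hp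
  have hθ := smoothOn_slice H.1 p.1
  have h0' : ∀ x ∈ {x | (p.1, x) ∈ Ω}, θ p.1 x ≠ 0 := fun x hx => h0 (p.1, x) hx
  have hv := smoothOn_thetaToV hO hθ h0'
  have hu := smoothOn_vToU hO hv
  have hu1 := smoothOn_deriv hO hu
  have e := eqOn_deriv_of_hasDerivAt hO (eqOn_thetaFlow hO hθ h0') (fun y hy =>
    (hasDerivAt_of_smoothOn hO hθ hy).mul (((hasDerivAt_of_smoothOn hO hu1 hy).const_mul 2).add
      (((hasDerivAt_of_smoothOn hO hu hy).const_mul 4).mul (hasDerivAt_of_smoothOn hO hv hy)))) hx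
  have := h0 p hp
  rw [e, eqOn_thetaFlow hO hθ h0' hx, eqOn_vFlow hO hv hx]
  field_simp
  ring

theorem IsSolutionOn.comp_rhoToV (hΩ : IsOpen Ω) (h0 : ∀ p ∈ Ω, ρ p.1 p.2 ≠ 0)
    (H : IsSolutionOn Ω rhoFlow ρ) : IsSolutionOn Ω vFlow (fun t => rhoToV (ρ t)) := by
  refine ((H.isFlowOn hΩ).comp_rhoToV h0).isSolutionOn fun p hp => ?_
  have hO := isOpen_slice hΩ p.1
  have hx : p.2 ∈ {x | (p.1, x) ∈ Ω} := hp
  have hρ := smoothOn_slice H.1 p.1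
  have h0' : ∀ x ∈ {x | (p.1, x) ∈ Ω}, ρ p.1 x ≠ 0 := fun x hx => h0 (p.1, x) hx
  have hv := smoothOn_rhoToV hO hρ h0'
  have hu := smoothOn_vToU hO hv
  have hu1 := smoothOn_deriv hO hu
  have e := eqOn_deriv_of_hasDerivAt hO (eqOn_rhoFlow hO hρ h0') (fun y hy =>
    (((hasDerivAt_of_smoothOn hO hu1 hy).mul (hasDerivAt_of_smoothOn hO hρ hy)).add
      ((hasDerivAt_of_smoothOn hO hu hy).mul
        (hasDerivAt_of_smoothOn hO (smoothOn_deriv hO hρ) hy))).const_mul 2) hx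
  have := h0 p hp
  rw [e, eqOn_rhoFlow hO hρ h0' hx, eqOn_vFlow hO hv hx]
  have hv0 : rhoToV (ρ p.1) p.2 = 1 / 2 * (ρ p.1 p.2 + deriv (ρ p.1) p.2 / ρ p.1 p.2) := rfl
  simp only [deriv_rhoToV hO hρ h0' hx, hv0]
  field_simp
  ring

theorem smoothOn_etaToU {O : Set ℝ} {η : ℝ → ℂ} (hO : IsOpen O) (hη : ContDiffOn ℝ ∞ η O)
    (h1 : ∀ x ∈ O, deriv η x ≠ 0) : ContDiffOn ℝ ∞ (etaToU η) O := by
  refine (smoothOn_vToU hO (v := etaToV η) ?_).congr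
    fun x hx => (eqOn_vToU_etaToV hO hη h1 hx).symm
  rw [← thetaToV_etaToTheta]
  exact smoothOn_thetaToV hO (smoothOn_deriv hO hη) h1

theorem eqOn_deriv_etaFlow {O : Set ℝ} {η : ℝ → ℂ} (hO : IsOpen O) (hη : ContDiffOn ℝ ∞ η O)
    (h1 : ∀ x ∈ O, deriv η x ≠ 0) : EqOn (deriv (etaFlow η)) (fun x =>
      2 * (deriv (etaToU η) x * deriv η x + etaToU η x * deriv (deriv η) x)) O :=
  eqOn_deriv_of_hasDerivAt hO (fun x _ => etaFlow_eq η x) fun x hx => by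
    refine (((hasDerivAt_of_smoothOn hO (smoothOn_etaToU hO hη h1) hx).const_mul 2).mul
      (hasDerivAt_of_smoothOn hO (smoothOn_deriv hO hη) hx)).congr_deriv ?_
    ring

theorem IsSolutionOn.comp_etaToTheta (hΩ : IsOpen Ω) (h1 : ∀ p ∈ Ω, deriv (η p.1) p.2 ≠ 0)
    (H : IsSolutionOn Ω etaFlow η) : IsSolutionOn Ω thetaFlow (fun t => etaToTheta (η t)) := by
  refine IsFlowOn.isSolutionOn (H.isFlowOn hΩ).deriv_snd fun p hp => ?_
  have hO := isOpen_slice hΩ p.1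
  have hx : p.2 ∈ {x | (p.1, x) ∈ Ω} := hp
  have hη := smoothOn_slice H.1 p.1
  have h1' : ∀ x ∈ {x | (p.1, x) ∈ Ω}, deriv (η p.1) x ≠ 0 := fun x hx => h1 (p.1, x) hx
  have hU := eqOn_vToU_etaToV hO hη h1'
  have := h1 p hp
  rw [eqOn_deriv_etaFlow hO hη h1' hx, eqOn_thetaFlow (θ := etaToTheta (η p.1)) hO
    (smoothOn_deriv hO hη) h1' hx]
  simp only [thetaToV_etaToTheta, hU hx, eqOn_deriv hO hU hx]
  rw [etaToTheta, etaToV, iteratedDeriv_two]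
  field_simp
  ring

theorem IsSolutionOn.comp_etaToRho (hΩ : IsOpen Ω) (h1 : ∀ p ∈ Ω, deriv (η p.1) p.2 ≠ 0)
    (h0 : ∀ p ∈ Ω, η p.1 p.2 ≠ 0) (H : IsSolutionOn Ω etaFlow η) :
    IsSolutionOn Ω rhoFlow (fun t => etaToRho (η t)) := by
  refine ((H.isFlowOn hΩ).comp_etaToRho h0).isSolutionOn fun p hp => ?_
  have hO := isOpen_slice hΩ p.1
  have hx : p.2 ∈ {x | (p.1, x) ∈ Ω} := hp
  have hη := smoothOn_slice H.1 p.1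
  have hη1 := smoothOn_deriv hO hη
  have h1' : ∀ x ∈ {x | (p.1, x) ∈ Ω}, deriv (η p.1) x ≠ 0 := fun x hx => h1 (p.1, x) hx
  have h0' : ∀ x ∈ {x | (p.1, x) ∈ Ω}, η p.1 x ≠ 0 := fun x hx => h0 (p.1, x) hx
  have hU := (eqOn_vToU hO (eqOn_rhoToV_etaToRho hO hη h1' h0')).trans
    (eqOn_vToU_etaToV hO hη h1')
  have hd : deriv (etaToRho (η p.1)) p.2 = _ := ((hasDerivAt_of_smoothOn hO hη1 hx).div
    (hasDerivAt_of_smoothOn hO hη hx) (h0 p hp)).deriv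
  have := h0 p hp
  rw [eqOn_deriv_etaFlow hO hη h1' hx, eqOn_rhoFlow (ρ := etaToRho (η p.1)) hO
    (smoothOn_div hη1 hη h0') (fun x hx => div_ne_zero (h1' x hx) (h0' x hx)) hx]
  simp only [hU hx, eqOn_deriv hO hU hx, hd, etaFlow_eq]
  rw [etaToRho]
  field_simp
  ring

theorem IsSolutionOn.comp_etaToV (hΩ : IsOpen Ω) (h1 : ∀ p ∈ Ω, deriv (η p.1) p.2 ≠ 0)
    (H : IsSolutionOn Ω etaFlow η) : IsSolutionOn Ω vFlow (fun t => etaToV (η t)) := by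
  have := (H.comp_etaToTheta hΩ h1).comp_thetaToV hΩ h1
  simpa only [thetaToV_etaToTheta] using this

theorem IsSolutionOn.comp_etaToU (hΩ : IsOpen Ω) (h1 : ∀ p ∈ Ω, deriv (η p.1) p.2 ≠ 0)
    (H : IsSolutionOn Ω etaFlow η) : IsSolutionOn Ω uFlow (fun t => etaToU (η t)) := by
  -- The two expressions for u are known to agree only on the slices of Ω, where η' is nonzero;
  -- openness of the slices lets their x-derivatives be compared as well.
  have hU : ∀ t, EqOn (etaToU (η t)) (vToU (etaToV (η t))) {x | (t, x) ∈ Ω} := fun t =>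
    (eqOn_vToU_etaToV (isOpen_slice hΩ t) (smoothOn_slice H.1 t) fun x hx => h1 (t, x) hx).symm
  refine ((((H.comp_etaToV hΩ h1).comp_vToU hΩ).isFlowOn hΩ).congr
    fun p hp => hU p.1 hp).isSolutionOn fun p hp => ?_
  exact eqOn_uFlow (isOpen_slice hΩ p.1) (hU p.1) hp

end Solutions

/-! ### The Hamiltonian vector fields of `∫ u²` -/

section Generates

variable {a b : ℝ} {f η θ ρ v u : ℝ → ℂ}

theorem smooth_ofReal : ContDiff ℝ ∞ fun s : ℝ => (s : ℂ) := Complex.ofRealCLM.contDiff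

/-- The straight line through `q` with direction `h`. -/
theorem isFlowOn_line {q h : ℝ → ℂ} (hq : ContDiff ℝ ∞ q) (hh : ContDiff ℝ ∞ h) :
    IsFlowOn univ (fun s x => q x + (s : ℂ) * h x) (fun _ => h) := by
  refine ⟨isOpen_univ, ContDiff.contDiffOn ?_, fun p _ => ?_⟩
  · exact (hq.comp contDiff_snd).add
      ((smooth_ofReal.comp contDiff_fst).mul (hh.comp contDiff_snd))
  · have : HasDerivAt (fun s : ℝ => (s : ℂ)) 1 p.1 := Complex.ofRealCLM.hasDerivAt
    simpa using (this.mul_const (h p.2)).const_add (q p.2)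

theorem line_zero (q h : ℝ → ℂ) : (fun x => q x + ((0 : ℝ) : ℂ) * h x) = q := by
  funext x
  simp

/-- The points where a smooth family does not vanish. -/
theorem IsFlowOn.restrict_ne_zero {Q h R k : ℝ → ℝ → ℂ} (H : IsFlowOn univ Q h)
    (K : IsFlowOn univ R k) : IsFlowOn {p | R p.1 p.2 ≠ 0} Q h :=
  H.mono (isOpen_ne_fun (contDiffOn_univ.1 K.smooth).continuous continuous_const) (subset_univ _)

theorem eq_zero_of_notMem_Ioo (hs : tsupport f ⊆ Ioo a b) {x : ℝ} (hx : x ∉ Ioo a b) : f x = 0 :=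
  image_eq_zero_of_notMem_tsupport fun h => hx (hs h)

theorem tsupport_deriv_subset_Ioo (hs : tsupport f ⊆ Ioo a b) : tsupport (deriv f) ⊆ Ioo a b :=
  (closure_minimal (support_deriv_subset) (isClosed_tsupport f)).trans hs

/-- The boundary terms of k vanish, and ∫fV over [a, b] is the integral over the line because f is
supported in (a, b). -/
theorem intervalIntegral_eq_neg_integral {k G V : ℝ → ℂ} (hs : tsupport f ⊆ Ioo a b)
    (hf : IsTest f) (hG : Continuous G) (hV : Continuous V) (ha : k a = 0) (hb : k b = 0)
    (hk : ∀ x, HasDerivAt k (G x + f x * V x) x) :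
    ∫ x in a..b, G x = -∫ x, f x * V x := by
  have hfV : Continuous fun x => f x * V x := hf.1.continuous.mul hV
  have h1 := intervalIntegral.integral_eq_sub_of_hasDerivAt (fun x _ => hk x)
    ((hG.add hfV).intervalIntegrable a b)
  rw [intervalIntegral.integral_add (hG.intervalIntegrable a b) (hfV.intervalIntegrable a b),
    intervalIntegral.integral_eq_integral_of_support_subset (f := fun x => f x * V x) (fun x hx =>
      Ioo_subset_Ioc_self (hs (subset_tsupport f (left_ne_zero_of_mul hx)))), ha, hb, sub_zero] at h1
  exact eq_neg_of_add_eq_zero_left h1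

theorem generates_uFlow (hab : a < b) : uSpace.Generates a b (energy a b) uFlow := by
  intro u (hu : ContDiff ℝ ∞ u) f hf hs
  have f1 := hf.deriv
  have f2 := f1.deriv
  have hu1 := smooth_deriv hu
  have hu2 := smooth_deriv hu1
  have d := fun x => hasDerivAt_of_smooth hu x
  have d1 := fun x => hasDerivAt_of_smooth hu1 x
  have d2 := fun x => hasDerivAt_of_smooth hu2 x
  have df := fun x => hasDerivAt_of_smooth hf.1 x
  have df1 := fun x => hasDerivAt_of_smooth f1.1 x
  have df2 := fun x => hasDerivAt_of_smooth f2.1 x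
  have hP : uPoisson u f = fun x => 1 / 2 * deriv (deriv (deriv f)) x + u x * deriv f x +
      (deriv u x * f x + u x * deriv f x) := funext fun x => by
    rw [uPoisson, iteratedDeriv_three, ((d x).fun_mul (df x)).deriv]
  have hPs : ContDiff ℝ ∞ (uPoisson u f) := by
    rw [hP]
    exact ((contDiff_const.mul f2.deriv.1).add (hu.mul f1.1)).add ((hu1.mul hf.1).add (hu.mul f1.1))
  have hV : uFlow u = fun x => deriv (deriv (deriv u)) x + 6 * u x * deriv u x := funext fun x => by
    rw [uFlow, iteratedDeriv_three]
  have H := (isFlowOn_line hu hPs).hasDerivAt_energy hab.le (fun x _ => mem_univ _)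
  refine H.congr_deriv ?_
  simp only [Complex.ofReal_zero, zero_mul, add_zero]
  -- The boundary terms of integrating uf''' by parts three times, plus 4u²f from 4u²f'.
  refine intervalIntegral_eq_neg_integral (k := fun x => u x * deriv (deriv f) x -
    deriv u x * deriv f x + deriv (deriv u) x * f x + 4 * u x ^ 2 * f x) hs hf
    ((continuous_const.mul hu.continuous).mul hPs.continuous) ?_ ?_ ?_ fun x => ?_
  · rw [hV]
    exact ((smooth_deriv hu2).add ((contDiff_const.mul hu).mul hu1)).continuous
  · have s1 := tsupport_deriv_subset_Ioo hs
    simp [eq_zero_of_notMem_Ioo hs, eq_zero_of_notMem_Ioo s1,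
      eq_zero_of_notMem_Ioo (tsupport_deriv_subset_Ioo s1)]
  · have s1 := tsupport_deriv_subset_Ioo hs
    simp [eq_zero_of_notMem_Ioo hs, eq_zero_of_notMem_Ioo s1,
      eq_zero_of_notMem_Ioo (tsupport_deriv_subset_Ioo s1)]
  · refine (((((d x).mul (df2 x)).sub ((d1 x).mul (df1 x))).add ((d2 x).mul (df x))).add
      ((((d x).pow 2).const_mul 4).mul (df x))).congr_deriv ?_
    simp only [hP, hV, Pi.pow_apply]
    push_cast
    ring

theorem generates_vFlow (hab : a < b) :
    vSpace.Generates a b (fun v => energy a b (vToU v)) vFlow := by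
  intro v (hv : ContDiff ℝ ∞ v) f hf hs
  have hu : ContDiff ℝ ∞ (vToU v) := (smooth_deriv hv).sub (hv.pow 2)
  have hu1 := smooth_deriv hu
  have hV : vFlow v = fun x => deriv (deriv (vToU v)) x +
      2 * (deriv v x * vToU v x + v x * deriv (vToU v) x) :=
    funext fun x => eqOn_vFlow isOpen_univ hv.contDiffOn (mem_univ x)
  have hPs : ContDiff ℝ ∞ (vPoisson v f) := contDiff_const.mul hf.deriv.1
  have hP1 : deriv (vPoisson v f) = fun x => -(1 / 2) * deriv (deriv f) x := funext fun x =>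
    ((hasDerivAt_of_smooth hf.deriv.1 x).const_mul _).deriv
  have H := (isFlowOn_line hv hPs).comp_vToU.hasDerivAt_energy hab.le (fun x _ => mem_univ _)
  refine H.congr_deriv ?_
  simp only [line_zero]
  simp only [Complex.ofReal_zero, zero_mul, add_zero]
  refine intervalIntegral_eq_neg_integral (k := fun x => -(vToU v x * deriv f x) +
    deriv (vToU v) x * f x + 2 * (vToU v x * v x) * f x) hs hf ((continuous_const.mul
      hu.continuous).mul ((smooth_deriv hPs).continuous.sub ((continuous_const.mul
        hv.continuous).mul hPs.continuous))) ?_ ?_ ?_ fun x => ?_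
  · rw [hV]
    exact ((smooth_deriv hu1).add (contDiff_const.mul (((smooth_deriv hv).mul hu).add
      (hv.mul hu1)))).continuous
  · simp [eq_zero_of_notMem_Ioo hs, eq_zero_of_notMem_Ioo (tsupport_deriv_subset_Ioo hs)]
  · simp [eq_zero_of_notMem_Ioo hs, eq_zero_of_notMem_Ioo (tsupport_deriv_subset_Ioo hs)]
  · have d := hasDerivAt_of_smooth hu x
    have df := hasDerivAt_of_smooth hf.1 x
    refine (((d.mul (hasDerivAt_of_smooth hf.deriv.1 x)).neg.add
      ((hasDerivAt_of_smooth hu1 x).mul df)).add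
      (((d.mul (hasDerivAt_of_smooth hv x)).const_mul 2).mul df)).congr_deriv ?_
    simp only [hP1, hV, vPoisson, Pi.mul_apply]
    ring

theorem generates_thetaFlow (hab : a < b) :
    thetaSpace.Generates a b (fun θ => energy a b (vToU (thetaToV θ))) thetaFlow := by
  intro θ hθ f hf hs
  have hv : ContDiff ℝ ∞ (thetaToV θ) :=
    contDiff_const.mul (smooth_div (smooth_deriv hθ.1) hθ.1 hθ.2)
  have hu : ContDiff ℝ ∞ (vToU (thetaToV θ)) := (smooth_deriv hv).sub (hv.pow 2)
  have hu1 := smooth_deriv hu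
  have hV : thetaFlow θ = fun x => θ x * (2 * deriv (vToU (thetaToV θ)) x +
      4 * vToU (thetaToV θ) x * thetaToV θ x) :=
    funext fun x => eqOn_thetaFlow isOpen_univ hθ.1.contDiffOn (fun x _ => hθ.2 x) (mem_univ x)
  have hPs := smooth_thetaPoisson hθ.1 hf
  have hw : ∀ x, 1 / 2 * ((deriv (thetaPoisson θ f) x * θ x -
      deriv θ x * thetaPoisson θ f x) / θ x ^ 2) = θ x * f x := fun x => by
    have h1 := ((hasDerivAt_of_smooth hθ.1 x).fun_mul
      (hasDerivAt_sgnInt (hf.mul_left hθ.1) x)).deriv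
    rw [funext (thetaPoisson_eq θ f), h1]
    have := hθ.2 x
    field_simp
    ring
  have hline := isFlowOn_line hθ.1 hPs
  -- The line need not stay in the space of nonvanishing fields, so the family is restricted to the
  -- open set where it is nonzero; at s = 0 this contains all of [a, b].
  have H := (((hline.restrict_ne_zero hline).comp_thetaToV
    (fun _ hp => hp)).comp_vToU).hasDerivAt_energy hab.le (fun x _ => by simpa using hθ.2 x)
  refine H.congr_deriv ?_
  simp only [line_zero]
  simp only [Complex.ofReal_zero, zero_mul, add_zero, hw]
  have hθf := hθ.1.mul hf.1
  refine intervalIntegral_eq_neg_integral (k := fun x => 2 * (vToU (thetaToV θ) x * (θ x * f x)))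
    hs hf ((continuous_const.mul hu.continuous).mul ((smooth_deriv hθf).continuous.sub
      ((continuous_const.mul hv.continuous).mul hθf.continuous))) ?_ ?_ ?_ fun x => ?_
  · rw [hV]
    exact (hθ.1.mul ((contDiff_const.mul hu1).add ((contDiff_const.mul hu).mul hv))).continuous
  · simp [eq_zero_of_notMem_Ioo hs]
  · simp [eq_zero_of_notMem_Ioo hs]
  · refine (((hasDerivAt_of_smooth hu x).mul (hasDerivAt_of_smooth hθf x)).const_mul
      2).congr_deriv ?_
    simp only [hV]
    ring

theorem generates_rhoFlow (hab : a < b) :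
    rhoSpace.Generates a b (fun ρ => energy a b (vToU (rhoToV ρ))) rhoFlow := by
  intro ρ hρ f hf hs
  have hv : ContDiff ℝ ∞ (rhoToV ρ) :=
    contDiff_const.mul (hρ.1.add (smooth_div (smooth_deriv hρ.1) hρ.1 hρ.2))
  have hu : ContDiff ℝ ∞ (vToU (rhoToV ρ)) := (smooth_deriv hv).sub (hv.pow 2)
  have hu1 := smooth_deriv hu
  have hV : rhoFlow ρ = fun x => 2 * (deriv (vToU (rhoToV ρ)) x * ρ x +
      vToU (rhoToV ρ) x * deriv ρ x) :=
    funext fun x => eqOn_rhoFlow isOpen_univ hρ.1.contDiffOn (fun x _ => hρ.2 x) (mem_univ x)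
  have hPs := smooth_rhoPoisson hρ.1 hf
  obtain ⟨E, hEs, hE, hE0⟩ := exists_log_deriv_eq hρ.1
  have t1 := (hf.mul_left hρ.1).mul_left hEs
  have t2 := (hf.mul_left hρ.1).mul_left (g := fun y => (E y)⁻¹) (hEs.inv hE0)
  have d := fun x => hasDerivAt_of_smooth hρ.1 x
  have df := fun x => hasDerivAt_of_smooth hf.1 x
  have hw : ∀ x, 1 / 2 * (rhoPoisson ρ f x + (deriv (rhoPoisson ρ f) x * ρ x -
      deriv ρ x * rhoPoisson ρ f x) / ρ x ^ 2) = ρ x * f x + 1 / 2 * (ρ x * (E x *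
        (sgnInt (fun y => (E y)⁻¹ * (ρ y * f y)) x - ∫ y, (E y)⁻¹ * (ρ y * f y)))) :=
    fun x => by
      have h1 := ((d x).fun_mul (((((hE x).fun_inv (hE0 x)).fun_mul
        ((hasDerivAt_sgnInt t1 x).const_add (∫ y, E y * (ρ y * f y)))).fun_add
        ((hE x).fun_mul ((hasDerivAt_sgnInt t2 x).sub_const
          (∫ y, (E y)⁻¹ * (ρ y * f y))))).const_mul (1 / 2))).deriv
      rw [funext (rhoPoisson_eq hρ.1 hEs hE hE0 hf), h1]
      have := hρ.2 x
      have := hE0 x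
      field_simp
      ring
  -- ρE solves y' = 2vy, so ∂ - 2v annihilates the nonlocal part of δv up to a local term, and δu =
  -- ρf'.
  have hw1 : ∀ x, deriv (fun x => ρ x * f x + 1 / 2 * (ρ x * (E x *
        (sgnInt (fun y => (E y)⁻¹ * (ρ y * f y)) x - ∫ y, (E y)⁻¹ * (ρ y * f y))))) x -
      2 * rhoToV ρ x * (ρ x * f x + 1 / 2 * (ρ x * (E x *
        (sgnInt (fun y => (E y)⁻¹ * (ρ y * f y)) x - ∫ y, (E y)⁻¹ * (ρ y * f y))))) =
      ρ x * deriv f x := fun x => by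
    rw [(((d x).fun_mul (df x)).fun_add (((d x).fun_mul ((hE x).fun_mul
      ((hasDerivAt_sgnInt t2 x).sub_const _))).const_mul (1 / 2))).deriv, rhoToV]
    have := hρ.2 x
    have := hE0 x
    field_simp
    ring
  have hline := isFlowOn_line hρ.1 hPs
  have H := (((hline.restrict_ne_zero hline).comp_rhoToV
    (fun _ hp => hp)).comp_vToU).hasDerivAt_energy hab.le (fun x _ => by simpa using hρ.2 x)
  refine H.congr_deriv ?_
  simp only [line_zero]
  simp only [Complex.ofReal_zero, zero_mul, add_zero, hw, hw1]
  refine intervalIntegral_eq_neg_integral (k := fun x => 2 * (vToU (rhoToV ρ) x * ρ x) * f x)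
    hs hf ((continuous_const.mul hu.continuous).mul
      (hρ.1.continuous.mul hf.deriv.1.continuous)) ?_ ?_ ?_ fun x => ?_
  · rw [hV]
    exact (contDiff_const.mul ((hu1.mul hρ.1).add (hu.mul (smooth_deriv hρ.1)))).continuous
  · simp [eq_zero_of_notMem_Ioo hs]
  · simp [eq_zero_of_notMem_Ioo hs]
  · refine ((((hasDerivAt_of_smooth hu x).mul (d x)).const_mul 2).mul (df x)).congr_deriv ?_
    simp only [hV, Pi.mul_apply]
    ring

theorem generates_etaFlow (hab : a < b) :
    etaSpace.Generates a b (fun η => energy a b (etaToU η)) etaFlow := by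
  intro η hη f hf hs
  have hη1 := smooth_deriv hη.1
  have hv : ContDiff ℝ ∞ (etaToV η) := by
    rw [← thetaToV_etaToTheta]
    exact contDiff_const.mul (smooth_div (smooth_deriv hη1) hη1 hη.2)
  have hu : ContDiff ℝ ∞ (etaToU η) := by
    rw [← vToU_etaToV hη]
    exact (smooth_deriv hv).sub (hv.pow 2)
  have hPs := smooth_etaPoisson hη.1 hf
  have d := fun x => hasDerivAt_of_smooth hη.1 x
  have d1 := fun x => hasDerivAt_of_smooth hη1 x
  have s0 := fun x => hasDerivAt_sgnInt hf x
  have s1 := fun x => hasDerivAt_sgnInt (hf.mul_left hη.1) x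
  have hP1 : deriv (etaPoisson η f) = fun x => deriv η x * (η x * (∫ y, f y) -
      η x * sgnInt f x + sgnInt (fun y => η y * f y) x) :=
    funext fun x => (hasDerivAt_etaPoisson hη.1 hf x).deriv
  have hw : ∀ x, 1 / 2 * ((deriv (deriv (etaPoisson η f)) x * deriv η x -
      deriv (deriv η) x * deriv (etaPoisson η f) x) / deriv η x ^ 2) =
      1 / 2 * (deriv η x * ((∫ y, f y) - sgnInt f x)) := fun x => by
    have h1 := ((d1 x).fun_mul ((((d x).mul_const (∫ y, f y)).fun_sub
      ((d x).fun_mul (s0 x))).fun_add (s1 x))).deriv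
    rw [hP1, h1]
    have := hη.2 x
    field_simp
    ring
  -- η' solves y' = 2vy, so only the derivative of the sign integral survives and δu = -η'f. Hence
  -- 2u δu + f·2uη' = 0 pointwise, and the primitive k can be taken to be 0.
  have hw1 : ∀ x, deriv (fun x => 1 / 2 * (deriv η x * ((∫ y, f y) - sgnInt f x))) x -
      2 * etaToV η x * (1 / 2 * (deriv η x * ((∫ y, f y) - sgnInt f x))) =
      -(deriv η x * f x) := fun x => by
    rw [(((d1 x).fun_mul ((s0 x).const_sub _)).const_mul (1 / 2)).deriv, etaToV, iteratedDeriv_two]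
    have := hη.2 x
    field_simp
    ring
  have hline := isFlowOn_line hη.1 hPs
  have hsmooth : ∀ s : ℝ, ContDiff ℝ ∞ fun x => η x + (s : ℂ) * etaPoisson η f x := fun s =>
    hη.1.add (contDiff_const.mul hPs)
  have hflow := ((hline.deriv_snd.restrict_ne_zero hline.deriv_snd).comp_thetaToV
    (fun _ hp => hp)).comp_vToU.congr
    (R := fun s => etaToU fun x => η x + (s : ℂ) * etaPoisson η f x) fun p hp => by
      have := eqOn_vToU_etaToV (isOpen_slice (isOpen_ne_fun
        (contDiffOn_univ.1 hline.deriv_snd.smooth).continuous continuous_const) p.1)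
        (hsmooth p.1).contDiffOn (fun x hx => hx) (x := p.2) hp
      rw [← this, ← thetaToV_etaToTheta]
      rfl
  have H := hflow.hasDerivAt_energy hab.le fun x _ => by
    simp only [line_zero, mem_ofPred_eq]
    exact hη.2 x
  refine H.congr_deriv ?_
  simp only [line_zero, hw]
  have h2 : thetaToV (deriv η) = etaToV η := thetaToV_etaToTheta η
  simp only [h2, hw1]
  refine intervalIntegral_eq_neg_integral (k := fun _ => 0) hs hf ((continuous_const.mul
    hu.continuous).mul (hη1.continuous.mul hf.1.continuous).neg) ?_ rfl rfl fun x => ?_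
  · rw [funext (etaFlow_eq η)]
    exact (continuous_const.mul hu.continuous).mul hη1.continuous
  · refine (hasDerivAt_const x (0 : ℂ)).congr_deriv ?_
    rw [etaFlow_eq]
    ring

end Generates

/-! ### Quasi-periodic curves -/

section QuasiPeriodic

variable {η : ℝ → ℂ}

/-- Möbius invariance of the Schwarzian, through v: as det = 1, the shift divides η' by (βη + δ)²,
so v changes by -βη'/(βη + δ), and this change cancels in v' - v². -/
theorem QuasiPeriodic.etaToU_add (hη : η ∈ etaSpace.carrier) (hq : QuasiPeriodic η) (x : ℝ) :
    etaToU η (x + 2 * Real.pi) = etaToU η x := by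
  obtain ⟨M, hM⟩ := hq
  have hdet := M.det_coe
  rw [Matrix.det_fin_two] at hdet
  generalize M.1 0 0 = α at *
  generalize M.1 0 1 = β at *
  generalize M.1 1 0 = γ at *
  generalize M.1 1 1 = δ at *
  have hη1 := smooth_deriv hη.1
  have hη2 := smooth_deriv hη1
  have d := fun x => hasDerivAt_of_smooth hη.1 x
  have d1 := fun x => hasDerivAt_of_smooth hη1 x
  -- A zero denominator would force a zero numerator, giving the invertible matrix the nonzero left
  -- null vector (η, 1).
  have hne : ∀ x, β * η x + δ ≠ 0 := fun x h => by
    have h1 := hM x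
    rw [h, mul_zero] at h1
    have h2 : (1 : ℂ) = 0 := by linear_combination (-1 : ℂ) * hdet + α * h + β * h1
    exact one_ne_zero h2
  have dd : ∀ x, HasDerivAt (fun x => β * η x + δ) (β * deriv η x) x := fun x =>
    ((d x).const_mul β).add_const δ
  have e0 : (fun x => η (x + 2 * Real.pi)) = fun x => (α * η x + γ) / (β * η x + δ) :=
    funext fun x => (eq_div_iff (hne x)).2 (hM x)
  have e1 : (fun x => deriv η (x + 2 * Real.pi)) = fun x => deriv η x / (β * η x + δ) ^ 2 := by
    funext x
    have h1 := (((d x).const_mul α).add_const γ).fun_div (dd x) (hne x)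
    rw [← deriv_comp_add_const, e0, h1.deriv]
    have := hne x
    field_simp
    linear_combination deriv η x * hdet
  have e2 : (fun x => deriv (deriv η) (x + 2 * Real.pi)) = fun x =>
      deriv (deriv η) x / (β * η x + δ) ^ 2 - 2 * β * deriv η x ^ 2 / (β * η x + δ) ^ 3 := by
    funext x
    have h1 := (d1 x).fun_div ((dd x).fun_pow 2) (pow_ne_zero 2 (hne x))
    rw [← deriv_comp_add_const, e1, h1.deriv]
    have := hne x
    push_cast
    field_simp
  have e3 : ∀ x, etaToV η (x + 2 * Real.pi) = etaToV η x - β * deriv η x / (β * η x + δ) :=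
    fun x => by
      have := hne x
      have := hη.2 x
      have h1 := congrFun e1 x
      have h2 := congrFun e2 x
      rw [etaToV, etaToV, iteratedDeriv_two, h1, h2]
      field_simp
  have hv : ContDiff ℝ ∞ (etaToV η) := by
    rw [← thetaToV_etaToTheta]
    exact contDiff_const.mul (smooth_div hη2 hη1 hη.2)
  have e4 : deriv (etaToV η) (x + 2 * Real.pi) = deriv (etaToV η) x -
      (β * deriv (deriv η) x * (β * η x + δ) - β * deriv η x * (β * deriv η x)) /
        (β * η x + δ) ^ 2 := by
    rw [← deriv_comp_add_const, funext e3]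
    exact ((hasDerivAt_of_smooth hv x).fun_sub
      (((d1 x).const_mul β).fun_div (dd x) (hne x))).deriv
  rw [← vToU_etaToV hη, vToU, vToU, e4, e3, etaToV, iteratedDeriv_two]
  have := hne x
  have := hη.2 x
  field_simp
  ring

theorem QuasiPeriodic.energy_eq (hη : η ∈ etaSpace.carrier) (hq : QuasiPeriodic η) (a : ℝ) :
    energy a (a + 2 * Real.pi) (etaToU η) = energy 0 (2 * Real.pi) (etaToU η) := by
  have h : Function.Periodic (fun x => etaToU η x ^ 2) (2 * Real.pi) := fun x => by
    simp only [hq.etaToU_add hη]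
  simpa only [zero_add, energy] using h.intervalIntegral_add_eq a 0

end QuasiPeriodic

end KdVTower

end

theorem mainTheorem7 :
    -- the arrows of the diagram are Poisson maps
    (KdVTower.IsPoissonMap KdVTower.etaSpaceStar KdVTower.rhoSpace KdVTower.etaToRho ∧
      KdVTower.IsPoissonMap KdVTower.etaSpace KdVTower.thetaSpace KdVTower.etaToTheta ∧
      KdVTower.IsPoissonMap KdVTower.etaSpace KdVTower.vSpace KdVTower.etaToV ∧
      KdVTower.IsPoissonMap KdVTower.etaSpace KdVTower.uSpace KdVTower.etaToU ∧
      KdVTower.IsPoissonMap KdVTower.rhoSpace KdVTower.vSpace KdVTower.rhoToV ∧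
      KdVTower.IsPoissonMap KdVTower.thetaSpace KdVTower.vSpace KdVTower.thetaToV ∧
      KdVTower.IsPoissonMap KdVTower.vSpace KdVTower.uSpace KdVTower.vToU) ∧
    -- the diagram commutes
    ((∀ η ∈ KdVTower.etaSpaceStar.carrier,
        KdVTower.rhoToV (KdVTower.etaToRho η) = KdVTower.etaToV η) ∧
      (∀ η ∈ KdVTower.etaSpace.carrier,
        KdVTower.thetaToV (KdVTower.etaToTheta η) = KdVTower.etaToV η) ∧
      (∀ η ∈ KdVTower.etaSpace.carrier,
        KdVTower.vToU (KdVTower.etaToV η) = KdVTower.etaToU η)) ∧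
    -- on each level the Hamiltonian `∫ u²` generates the equation of the diagram
    (∀ a b : ℝ, a < b →
      KdVTower.etaSpace.Generates a b
          (fun η => KdVTower.energy a b (KdVTower.etaToU η)) KdVTower.etaFlow ∧
        KdVTower.rhoSpace.Generates a b
          (fun ρ => KdVTower.energy a b (KdVTower.vToU (KdVTower.rhoToV ρ))) KdVTower.rhoFlow ∧
        KdVTower.thetaSpace.Generates a b
          (fun θ => KdVTower.energy a b (KdVTower.vToU (KdVTower.thetaToV θ)))
          KdVTower.thetaFlow ∧
        KdVTower.vSpace.Generates a b
          (fun v => KdVTower.energy a b (KdVTower.vToU v)) KdVTower.vFlow ∧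
        KdVTower.uSpace.Generates a b (KdVTower.energy a b) KdVTower.uFlow) ∧
    -- for a quasi-periodic curve, `u` lives on the circle and any period may be used in `∫ u²`
    (∀ η ∈ KdVTower.etaSpace.carrier, KdVTower.QuasiPeriodic η →
      (∀ x, KdVTower.etaToU η (x + 2 * Real.pi) = KdVTower.etaToU η x) ∧
        ∀ a, KdVTower.energy a (a + 2 * Real.pi) (KdVTower.etaToU η) =
          KdVTower.energy 0 (2 * Real.pi) (KdVTower.etaToU η)) ∧
    -- the differential substitutions map solutions to solutions
    (∀ Ω : Set (ℝ × ℝ), IsOpen Ω →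
      (∀ η : ℝ → ℝ → ℂ, (∀ p ∈ Ω, deriv (η p.1) p.2 ≠ 0) →
        KdVTower.IsSolutionOn Ω KdVTower.etaFlow η →
          ((∀ p ∈ Ω, η p.1 p.2 ≠ 0) →
            KdVTower.IsSolutionOn Ω KdVTower.rhoFlow (fun t => KdVTower.etaToRho (η t))) ∧
          KdVTower.IsSolutionOn Ω KdVTower.thetaFlow (fun t => KdVTower.etaToTheta (η t)) ∧
          KdVTower.IsSolutionOn Ω KdVTower.vFlow (fun t => KdVTower.etaToV (η t)) ∧
          KdVTower.IsSolutionOn Ω KdVTower.uFlow (fun t => KdVTower.etaToU (η t))) ∧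
      (∀ ρ : ℝ → ℝ → ℂ, (∀ p ∈ Ω, ρ p.1 p.2 ≠ 0) →
        KdVTower.IsSolutionOn Ω KdVTower.rhoFlow ρ →
          KdVTower.IsSolutionOn Ω KdVTower.vFlow (fun t => KdVTower.rhoToV (ρ t))) ∧
      (∀ θ : ℝ → ℝ → ℂ, (∀ p ∈ Ω, θ p.1 p.2 ≠ 0) →
        KdVTower.IsSolutionOn Ω KdVTower.thetaFlow θ →
          KdVTower.IsSolutionOn Ω KdVTower.vFlow (fun t => KdVTower.thetaToV (θ t))) ∧
      (∀ v : ℝ → ℝ → ℂ, KdVTower.IsSolutionOn Ω KdVTower.vFlow v →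
        KdVTower.IsSolutionOn Ω KdVTower.uFlow (fun t => KdVTower.vToU (v t)))) := by
  refine ⟨⟨KdVTower.isPoissonMap_etaToRho, KdVTower.isPoissonMap_etaToTheta,
    KdVTower.isPoissonMap_etaToV, KdVTower.isPoissonMap_etaToU, KdVTower.isPoissonMap_rhoToV,
    KdVTower.isPoissonMap_thetaToV, KdVTower.isPoissonMap_vToU⟩,
    ⟨fun η hη => KdVTower.rhoToV_etaToRho hη, fun η _ => KdVTower.thetaToV_etaToTheta η,
      fun η hη => KdVTower.vToU_etaToV hη⟩,
    fun a b hab => ⟨KdVTower.generates_etaFlow hab, KdVTower.generates_rhoFlow hab,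
      KdVTower.generates_thetaFlow hab, KdVTower.generates_vFlow hab,
      KdVTower.generates_uFlow hab⟩,
    fun η hη hq => ⟨hq.etaToU_add hη, hq.energy_eq hη⟩,
    fun Ω hΩ => ⟨fun η h1 H => ⟨fun h0 => H.comp_etaToRho hΩ h1 h0, H.comp_etaToTheta hΩ h1,
      H.comp_etaToV hΩ h1, H.comp_etaToU hΩ h1⟩, fun ρ h0 H => H.comp_rhoToV hΩ h0,
      fun θ h0 H => H.comp_thetaToV hΩ h0, fun v H => H.comp_vToU hΩ⟩⟩
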